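/- Let $k$ be an algebraically closed field of characteristic zero and $\mathfrak g=\mathfrak g_{\bar 0}\oplus\mathfrak g_{\bar 1}$ a finite-dimensional Lie superalgebra over $k$ such that $\mathfrak g_{\bar 0}$ is reductive and $\mathfrak g$ carries an even, supersymmetric, invariant, nondegenerate bilinear form $(\cdot,\cdot)$ (for example a basic simple Lie superalgebra or $\mathfrak{gl}(m|n)$). Let $\theta$ be an automorphism of $\mathfrak g$ with $\theta^2=\mathrm{id}$ that preserves the form, and let $\mathfrak p$ be its $(-1)$-eigenspace. A toral subalgebra is an abelian subalgebra of $\mathfrak g_{\bar 0}$ whose elements act diagonalizably on $\mathfrak g$. Let $\mathfrak a$ be a maximal toral subalgebra of $\mathfrak p_{\bar 0}$, and let $\mathfrak h\supseteq\mathfrak a$ be a $\theta$-stable Cartan subalgebra of $\mathfrak g_{\bar 0}$ that is toral. Let $R\subset\mathfrak h^*\setminus\{0\}$ be the set of roots of $\mathfrak g$ (the nonzero weights of $\mathfrak h$ on $\mathfrak g$), write $\bar\alpha$ for the restriction of $\alpha\in\mathfrak h^*$ to $\mathfrak a$, and put $$\bar R=\{\bar\alpha:\alpha\in R,\ \bar\alpha\ne0\},\qquad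 \bar R_{re}=\{\bar\alpha:\alpha\in R,\ (\alpha,\alpha)\neq 0,\ \bar\alpha\neq0\},\qquad \bar R_{im}=\bar R\setminus\bar R_{re},$$ where $\mathfrak h^*$ and $\mathfrak a^*$ carry the bilinear forms induced by the invariant form restricted to $\mathfrak h$ and to $\mathfrak a$. Then: 1. The span of $\bar R$ is the space of all $\lambda\in\mathfrak a^*$ that vanish on $\mathfrak a\cap\mathfrak z(\mathfrak g)$, where $\mathfrak z(\mathfrak g)$ is the center of $\mathfrak g$. In particular, if $\theta$ fixes every even central element of $\mathfrak g$ (for example, if $\mathfrak g$ is simple), then $\bar R$ spans $\mathfrak a^*$. 2. The invariant form is nondegenerate on $\mathfrak h$ and on $\mathfrak a$, and the induced form on $\mathfrak a^*$ is nondegenerate. 3. If $\bar\alpha\in\bar R_{re}$, then $(\bar\alpha,\bar\alpha)\neq0$, and for all $\bar\beta\in\bar R$ we have $k_{\bar\alpha,\bar\beta}:=\dfrac{2(\bar\alpha,\bar\beta)}{(\bar\alpha,\bar\alpha)}\in\mathbb Z$ and $r_{\bar\alpha}(\bar\beta)=\bar\beta-k_{\bar\alpha,\bar\beta}\,\bar\alpha\in\bar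 R$. 4. If $\bar\alpha\in\bar R_{im}$ and $\bar\beta\in\bar R$ with $\bar\beta\neq\pm\bar\alpha$ and $(\bar\alpha,\bar\beta)\neq0$, then at least one of $\bar\beta+\bar\alpha$, $\bar\beta-\bar\alpha$ lies in $\bar R$. 5. $\bar R=-\bar R$. Further, $\bar R_{re}$ is a (crystallographic, possibly non-reduced) root system in the subspace of $\mathfrak a^*$ that it spans, with coroots $2(\bar\alpha,\cdot)/(\bar\alpha,\bar\alpha)$, and $\bar R_{im}$ is invariant under its Weyl group, the group generated by the reflections $r_{\bar\alpha}$ of $\mathfrak a^*$ for $\bar\alpha\in\bar R_{re}$. -/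

import Mathlib

open Module Submodule

noncomputable section

/-- A Lie superalgebra `𝔤 = L₀ ⊕ L₁` over `k`, given by its homogeneous parts: a Lie algebra `L₀`,
an `L₀`-module `L₁` (the bracket of an even and an odd element) and a symmetric bilinear bracket
`L₁ × L₁ → L₀`. The last two fields are the super Jacobi identity for one even and two odd
elements, and for three odd elements; for at least two even elements it is contained in the
assumptions that `L₀` is a Lie algebra and `L₁` a module over it. -/
class LieSuperalgebra (k L₀ L₁ : Type*) [Field k] [LieRing L₀] [LieAlgebra k L₀]
    [AddCommGroup L₁] [Module k L₁] [LieRingModule L₀ L₁] [LieModule k L₀ L₁] where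
  oddBracket : L₁ →ₗ[k] L₁ →ₗ[k] L₀
  oddBracket_symm : ∀ u v : L₁, oddBracket u v = oddBracket v u
  even_odd_odd : ∀ (x : L₀) (u v : L₁),
    ⁅x, oddBracket u v⁆ = oddBracket ⁅x, u⁆ v + oddBracket u ⁅x, v⁆
  odd_odd_odd : ∀ u v w : L₁,
    ⁅oddBracket u v, w⁆ + ⁅oddBracket v w, u⁆ + ⁅oddBracket w u, v⁆ = 0

namespace LieSuperalgebra

section Basic

variable (k L₀ L₁ : Type*) [Field k] [LieRing L₀] [LieAlgebra k L₀]
  [AddCommGroup L₁] [Module k L₁] [LieRingModule L₀ L₁] [LieModule k L₀ L₁]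

/-- A Lie algebra (over a field of characteristic zero) is reductive if its radical is its
center. -/
def IsReductive : Prop := LieAlgebra.radical k L₀ = LieAlgebra.center k L₀

/-- The even part of the center of `𝔤 = L₀ ⊕ L₁`. -/
def evenCenter : Submodule k L₀ where
  carrier := {x | (∀ y : L₀, ⁅x, y⁆ = 0) ∧ ∀ u : L₁, ⁅x, u⁆ = 0}
  add_mem' := by
    rintro x y ⟨hx, hx'⟩ ⟨hy, hy'⟩
    exact ⟨fun z => by simp [hx, hy], fun u => by simp [hx', hy']⟩
  zero_mem' := ⟨fun z => by simp, fun u => by simp⟩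
  smul_mem' := by
    rintro c x ⟨hx, hx'⟩
    exact ⟨fun z => by simp [hx], fun u => by simp [hx']⟩

variable [LieSuperalgebra k L₀ L₁]

/-- An even, supersymmetric, invariant, nondegenerate bilinear form on `𝔤 = L₀ ⊕ L₁`. Being even,
it is the sum of a form on `L₀` and one on `L₁`. The invariance `([x, y], z) = (x, [y, z])` is
stated for three even elements and for one even and two odd elements in the order
even-odd-odd; for the other orders it follows by supersymmetry. -/
structure InvariantForm where
  even : LinearMap.BilinForm k L₀
  odd : LinearMap.BilinForm k L₁
  even_symm : ∀ x y, even x y = even y x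
  odd_skew : ∀ u v, odd u v = -odd v u
  invariant_even : ∀ x y z : L₀, even ⁅x, y⁆ z = even x ⁅y, z⁆
  invariant_odd : ∀ (x : L₀) (u v : L₁), odd ⁅x, u⁆ v = even x (oddBracket (k := k) u v)
  even_nondegenerate : even.Nondegenerate
  odd_nondegenerate : odd.Nondegenerate

/-- An automorphism `θ` of the Lie superalgebra `𝔤 = L₀ ⊕ L₁` with `θ² = id`. -/
structure Involution where
  even : L₀ ≃ₗ⁅k⁆ L₀
  odd : L₁ ≃ₗ[k] L₁
  odd_lie : ∀ (x : L₀) (u : L₁), odd ⁅x, u⁆ = ⁅even x, odd u⁆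
  even_oddBracket : ∀ u v : L₁,
    even (oddBracket (k := k) u v) = oddBracket (k := k) (odd u) (odd v)
  even_even : ∀ x, even (even x) = x
  odd_odd : ∀ u, odd (odd u) = u

end Basic

section Toral

variable {k L₀ : Type*} (L₁ : Type*) [Field k] [LieRing L₀] [LieAlgebra k L₀]
  [AddCommGroup L₁] [Module k L₁] [LieRingModule L₀ L₁] [LieModule k L₀ L₁]

/-- A toral subalgebra of `𝔤 = L₀ ⊕ L₁`: an abelian subalgebra of `L₀` all of whose elements act
semisimply on `𝔤` in the adjoint representation. -/
structure IsToral (𝔟 : LieSubalgebra k L₀) : Prop where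
  lie_eq_zero : ∀ x ∈ 𝔟, ∀ y ∈ 𝔟, ⁅x, y⁆ = 0
  semisimple_even : ∀ x ∈ 𝔟, (LieModule.toEnd k L₀ L₀ x).IsSemisimple
  semisimple_odd : ∀ x ∈ 𝔟, (LieModule.toEnd k L₀ L₁ x).IsSemisimple

/-- The roots of `𝔤 = L₀ ⊕ L₁` with respect to `𝔥`: the nonzero weights, on the even or on
the odd part, of the adjoint action of `𝔥`. -/
def roots (𝔥 : LieSubalgebra k L₀) : Set (Dual k 𝔥) :=
  {α | α ≠ 0 ∧ ((∃ x : L₀, x ≠ 0 ∧ ∀ t : 𝔥, ⁅(t : L₀), x⁆ = α t • x) ∨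
    (∃ u : L₁, u ≠ 0 ∧ ∀ t : 𝔥, ⁅(t : L₀), u⁆ = α t • u))}

end Toral

section Restricted

variable {k L₀ L₁ : Type*} [Field k] [LieRing L₀] [LieAlgebra k L₀]
  [AddCommGroup L₁] [Module k L₁] [LieRingModule L₀ L₁] [LieModule k L₀ L₁]
  [LieSuperalgebra k L₀ L₁]

/-- `θ` preserves the form `B`. -/
def Involution.Preserves (θ : Involution k L₀ L₁) (B : InvariantForm k L₀ L₁) : Prop :=
  (∀ x y, B.even (θ.even x) (θ.even y) = B.even x y) ∧
    ∀ u v, B.odd (θ.odd u) (θ.odd v) = B.odd u v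

/-- `𝔞` is a maximal toral subalgebra of the even part of the `(-1)`-eigenspace of `θ`. -/
structure Involution.IsCartanSubspace (θ : Involution k L₀ L₁) (𝔞 : LieSubalgebra k L₀) :
    Prop where
  toral : IsToral L₁ 𝔞
  neg : ∀ x ∈ 𝔞, θ.even x = -x
  maximal : ∀ 𝔟 : LieSubalgebra k L₀, IsToral L₁ 𝔟 → (∀ x ∈ 𝔟, θ.even x = -x) → 𝔞 ≤ 𝔟 → 𝔟 = 𝔞

/-- `𝔥` is a `θ`-stable Cartan subalgebra of `𝔤` that contains `𝔞`. (A Cartan subalgebra of `𝔤`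
is a Cartan subalgebra of `L₀` that acts diagonalizably, so that `𝔤` is the sum of its weight
spaces.) -/
structure Involution.IsCartanOver (θ : Involution k L₀ L₁) (𝔞 𝔥 : LieSubalgebra k L₀) :
    Prop where
  cartan : 𝔥.IsCartanSubalgebra
  toral : IsToral L₁ 𝔥
  stable : ∀ x ∈ 𝔥, θ.even x ∈ 𝔥
  le : 𝔞 ≤ 𝔥

end Restricted

end LieSuperalgebra

section Form

variable {k V : Type*} [Field k] [AddCommGroup V] [Module k V]

open Classical in
/-- The bilinear form on the dual space that corresponds to a nondegenerate form `b` under the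
isomorphism `v ↦ b v` of `V` with its dual (and zero if `b` is degenerate). -/
def dualForm [FiniteDimensional k V] (b : LinearMap.BilinForm k V) :
    LinearMap.BilinForm k (Dual k V) :=
  if hb : b.Nondegenerate then b.comp (b.toDual hb).symm (b.toDual hb).symm else 0

/-- The orthogonal reflection `v ↦ v - (2 (a, v) / (a, a)) a`. -/
def formReflection (Q : LinearMap.BilinForm k V) (a : V) : V →ₗ[k] V :=
  LinearMap.id - ((2 / Q a a) • Q a).smulRight a

/-- The group generated by the orthogonal reflections in the elements of `Φ`. -/
def formWeylGroup (Q : LinearMap.BilinForm k V) (Φ : Set V) : Subgroup (V ≃ₗ[k] V) :=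
  Subgroup.closure {g | ∃ a ∈ Φ, (g : V →ₗ[k] V) = formReflection Q a}

/-- `Φ` is a (crystallographic, possibly non-reduced) root system in the subspace it spans, the
coroot of `a ∈ Φ` being `2 (a, ·) / (a, a)`. -/
def IsFormRootSystem (Q : LinearMap.BilinForm k V) (Φ : Set V) : Prop :=
  Φ.Finite ∧ ∃ P : RootPairing Φ k (span k Φ) (Dual k (span k Φ)),
    P.IsRootSystem ∧ P.IsCrystallographic ∧ (∀ x f, P.toLinearMap x f = f x) ∧
    (∀ a : Φ, (P.root a : V) = a) ∧
    ∀ (a : Φ) (x : span k Φ), P.coroot a x = 2 * Q a x / Q a a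

end Form

namespace LieSuperalgebra

variable {k L₀ L₁ : Type*} [Field k] [LieRing L₀] [LieAlgebra k L₀]
  [AddCommGroup L₁] [Module k L₁] [LieRingModule L₀ L₁] [LieModule k L₀ L₁]
  [LieSuperalgebra k L₀ L₁]

/-- The restriction of the invariant form to a subalgebra `𝔟` of `L₀`. -/
def InvariantForm.restrict (B : InvariantForm k L₀ L₁) (𝔟 : LieSubalgebra k L₀) :
    LinearMap.BilinForm k 𝔟 :=
  B.even.comp (𝔟.incl : 𝔟 →ₗ[k] L₀) (𝔟.incl : 𝔟 →ₗ[k] L₀)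

/-- The form on the dual of `𝔟` induced by the invariant form. -/
def InvariantForm.onDual [FiniteDimensional k L₀] (B : InvariantForm k L₀ L₁)
    (𝔟 : LieSubalgebra k L₀) : LinearMap.BilinForm k (Dual k 𝔟) :=
  dualForm (B.restrict 𝔟)

/-- Restriction of linear functions from `𝔥` to `𝔞`. -/
def res {𝔞 𝔥 : LieSubalgebra k L₀} (hle : 𝔞 ≤ 𝔥) : Dual k 𝔥 →ₗ[k] Dual k 𝔞 :=
  (LieSubalgebra.inclusion hle : 𝔞 →ₗ[k] 𝔥).dualMap

variable (L₁) in
/-- The restricted roots: the nonzero restrictions of the roots to `𝔞`. -/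
def restrictedRoots {𝔞 𝔥 : LieSubalgebra k L₀} (hle : 𝔞 ≤ 𝔥) : Set (Dual k 𝔞) :=
  {a | a ≠ 0 ∧ ∃ α ∈ roots L₁ 𝔥, res hle α = a}

/-- The real restricted roots: the nonzero restrictions of the roots `α` with `(α, α) ≠ 0`. -/
def realRestrictedRoots [FiniteDimensional k L₀] (B : InvariantForm k L₀ L₁)
    {𝔞 𝔥 : LieSubalgebra k L₀} (hle : 𝔞 ≤ 𝔥) : Set (Dual k 𝔞) :=
  {a | a ≠ 0 ∧ ∃ α ∈ roots L₁ 𝔥, B.onDual 𝔥 α α ≠ 0 ∧ res hle α = a}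

/-- The imaginary restricted roots: the restricted roots that are not real. -/
def imaginaryRestrictedRoots [FiniteDimensional k L₀] (B : InvariantForm k L₀ L₁)
    {𝔞 𝔥 : LieSubalgebra k L₀} (hle : 𝔞 ≤ 𝔥) : Set (Dual k 𝔞) :=
  restrictedRoots L₁ hle \ realRestrictedRoots B hle

end LieSuperalgebra

end

/-!
Write `τ χ = χ ∘ θ` on `𝔥*`. Maximality of `𝔞` is used twice. First, the `(-1)`-eigenspace of `θ`
on `𝔥` is a toral subalgebra of `𝔭₀` containing `𝔞`, hence equal to `𝔞`
(`mem_cartanSubspace_iff`). So `𝔥` is the orthogonal sum of `𝔞` and the fixed points of `θ`, and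
restriction to `𝔞` is the orthogonal projection `χ ↦ (χ - τ χ) / 2` (`onDual_res_res`). Since the
form is nondegenerate on the zero weight space, which is `𝔥`, it is nondegenerate on `𝔞`. Symmetry
of the set of roots comes from the duality of the weight spaces of `χ` and `-χ`, and the statement
on the span holds because the center is the common kernel of the roots.

For dual root vectors `x`, `y` of `α`, `-α`, even or odd, `[x, y]` is a nonzero multiple of the
element of `𝔥` representing `α`, so it acts by a nonzero scalar on the weight space of `β` when
`(α, β) ≠ 0`, and then `β + α` or `β - α` is a weight (`isWeight_add_or_sub`). If
`(ᾱ, β̄) ≠ 0`, then `α` or `-τ α`, which has the same restriction, is not orthogonal to `β`.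

If `α` is a nonisotropic even root, then `[x, y]` spans an `sl₂`-triple with `x` and `y`, and the
representation theory of `sl₂` shows that `2 (α, β) / (α, α)` is an integer and that the reflection
in `α` preserves the roots. The double of a nonisotropic odd root is an even root, so the same
holds for all nonisotropic roots (`root_reflection`), and they form a root system. In that root
system `α` and `α' = -τ α` have the same length, so their Cartan number is among `2`, `1`, `0`,
`-1`, `-2`. The value `-2` means that `α` vanishes on `𝔞`. The value `1` does not occur for an even
root `α`: it would make `[x, θ x]`, for `x` in the root space of `α`, a nonzero element of `𝔭₀` in
the root space of the nonisotropic root `α - α'`. Here maximality of `𝔞` enters for the second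
time: for a nonisotropic even root fixed by `τ` the root space meets `𝔭₀` trivially, since
otherwise an `sl₂`-triple with `e, f ∈ 𝔭₀` would yield the semisimple element `e + f`, by which `𝔞`
could be enlarged (`eq_zero_of_dualAct_eq_self`). In the remaining cases the reflection of `𝔞*` in
`ᾱ` is induced by the reflection in `α`, by the product of the reflections in the orthogonal roots
`α` and `α'`, or by the reflection in the root `α + α'` (`restricted_reflection_of_even`). As these
are isometries preserving the roots, the reflection preserves the restricted roots, and separately
the real ones, hence also the imaginary ones.
-/

/-! ### Semisimple operators and `sl₂`-triples -/

section Semisimple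

variable {k V : Type*} [Field k] [CharZero k] [AddCommGroup V] [Module k V]

lemma mul_pow_of_lie_eq_two_smul {H N : End k V} (hN : H * N = N * H + (2 : k) • N) (n : ℕ) :
    H * N ^ n = N ^ n * H + (2 * n : k) • N ^ n := by
  induction n with
  | zero => simp
  | succ n ih =>
    rw [pow_succ, ← mul_assoc, ih, add_mul, mul_assoc, hN, mul_add, smul_mul_assoc,
      mul_smul_comm, mul_assoc, add_assoc, ← add_smul]
    push_cast
    congr 2
    ring

variable [FiniteDimensional k V]

lemma isNilpotent_of_lie_eq_two_smul {H N : End k V} (hN : H * N = N * H + (2 : k) • N) :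
    IsNilpotent N := by
  by_contra h
  have h' : ∀ n, N ^ n ≠ 0 := fun n hn => h ⟨n, hn⟩
  -- the powers of `N` are eigenvectors of `ad H` with distinct eigenvalues
  have hli := Module.End.eigenvectors_linearIndependent'
    (LinearMap.mulLeft k H - LinearMap.mulRight k H) (fun n : ℕ => (2 * n : k))
    (fun a b hab => by simpa using hab) (fun n => N ^ n) (fun n =>
      ⟨by rw [Module.End.mem_eigenspace_iff]; simp [mul_pow_of_lie_eq_two_smul hN], h' n⟩)
  exact not_finite_iff_infinite.mpr inferInstance hli.finite

/-- With `M = -(s / 2) N`, the operator `exp M` conjugates `H` into `H + s N`. -/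
lemma Module.End.IsSemisimple.add_smul_of_lie_eq_two_smul {H N : End k V} (hH : H.IsSemisimple)
    (hN : H * N = N * H + (2 : k) • N) (s : k) : (H + s • N).IsSemisimple := by
  set M : End k V := (-(s / 2)) • N with hM
  have hsM : s • N = -((2 : k) • M) := by
    rw [hM, smul_smul, ← neg_smul]; congr 1; ring
  have hMH : H * M = M * H + (2 : k) • M := by
    rw [hM, mul_smul_comm, hN, smul_mul_assoc, smul_add, smul_comm]
  obtain ⟨n, hn⟩ := isNilpotent_of_lie_eq_two_smul hMH
  have hn1 : M ^ (n + 1) = 0 := by rw [pow_succ, hn, zero_mul]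
  set P : End k V := ∑ i ∈ Finset.range (n + 1), (i.factorial : k)⁻¹ • M ^ i with hP
  have hMP : M * P = ∑ i ∈ Finset.range n, (i.factorial : k)⁻¹ • M ^ (i + 1) := by
    rw [hP, Finset.mul_sum, Finset.sum_range_succ, mul_smul_comm, ← pow_succ', hn1, smul_zero,
      add_zero]
    simp only [mul_smul_comm, ← pow_succ']
  have hHP : H * P = P * H + (2 : k) • (M * P) := by
    rw [hMP, hP, Finset.mul_sum, Finset.sum_mul, Finset.smul_sum]
    simp only [mul_smul_comm, smul_mul_assoc, mul_pow_of_lie_eq_two_smul hMH, smul_add,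
      Finset.sum_add_distrib]
    congr 1
    rw [Finset.sum_range_succ']
    simp only [Nat.cast_zero, mul_zero, zero_smul, smul_zero, add_zero]
    refine Finset.sum_congr rfl fun i _ => ?_
    rw [smul_smul, smul_smul, Nat.factorial_succ]
    congr 1
    have h1 : (i.factorial : k) ≠ 0 := by exact_mod_cast i.factorial_ne_zero
    have h2 : (i + 1 : k) ≠ 0 := by exact_mod_cast i.succ_ne_zero
    push_cast
    field_simp
  have hU : IsUnit P := by
    set S : End k V := ∑ i ∈ Finset.range n, ((i + 1).factorial : k)⁻¹ • M ^ i with hS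
    have hPS : P = 1 + M * S := by
      rw [hP, Finset.sum_range_succ', hS, Finset.mul_sum, add_comm]
      simp [pow_succ']
    have hc : Commute M S := by
      refine Commute.sum_right _ _ _ fun i _ => ?_
      exact ((Commute.refl M).pow_right i).smul_right _
    rw [hPS]
    exact (hc.isNilpotent_mul_right ⟨n, hn⟩).isUnit_one_add
  obtain ⟨u, hu⟩ := hU
  have key : (H + s • N) * P = P * H := by
    rw [add_mul, hHP, hsM, neg_mul, smul_mul_assoc 2 M P, add_neg_cancel_right]
  refine (LinearEquiv.isSemisimple_iff (f := H) (H + s • N)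
    (LinearMap.GeneralLinearGroup.generalLinearEquiv k V u) ?_).mp hH
  ext v
  have := LinearMap.congr_fun key v
  simpa [← hu] using this.symm

end Semisimple

namespace IsSl2Triple

variable {k L M : Type*} [Field k] [CharZero k] [LieRing L] [LieAlgebra k L]
  [AddCommGroup M] [Module k M] [LieRingModule L M] [LieModule k L M] [FiniteDimensional k M]
  {h e f : L}

open LieModule

/-- The operators `h` and `e + f` both differ from `h + 2 f` by a nilpotent element on which
`h + 2 f` acts with eigenvalue `∓2`, so `e + f` is semisimple if `h` is. -/
lemma isSemisimple_toEnd_add (t : IsSl2Triple h e f) (hh : (toEnd k L M h).IsSemisimple) :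
    (toEnd k L M (e + f)).IsSemisimple := by
  have he : toEnd k L M h * toEnd k L M e - toEnd k L M e * toEnd k L M h
      = (2 : k) • toEnd k L M e := by
    ext m
    simp [← lie_lie, t.lie_h_e_smul k]
  have hf : toEnd k L M h * toEnd k L M f - toEnd k L M f * toEnd k L M h
      = -((2 : k) • toEnd k L M f) := by
    ext m
    simp [← lie_lie, t.lie_lie_smul_f k]
  have hef : toEnd k L M e * toEnd k L M f - toEnd k L M f * toEnd k L M e
      = toEnd k L M h := by
    ext m
    simp [← lie_lie, t.lie_e_f]
  rw [map_add]
  set a := toEnd k L M e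
  set b := toEnd k L M f
  set c := toEnd k L M h
  have h1 : (-c + (-2 : k) • b).IsSemisimple := by
    refine ((Module.End.isSemisimple_neg).mpr hh).add_smul_of_lie_eq_two_smul ?_ _
    rw [neg_mul, mul_neg, neg_eq_iff_eq_neg, neg_add, neg_neg, ← sub_eq_iff_eq_add', hf]
  have h2 : (c + (2 : k) • b).IsSemisimple := by
    rw [← Module.End.isSemisimple_neg]
    convert h1 using 1
    rw [neg_add, neg_smul]
  have h3 : ((c + (2 : k) • b) + (-1 : k) • (c - a + b)).IsSemisimple := by
    refine h2.add_smul_of_lie_eq_two_smul ?_ _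
    rw [← sub_eq_iff_eq_add']
    have : (c + (2 : k) • b) * (c - a + b) - (c - a + b) * (c + (2 : k) • b)
        = -(c * a - a * c) - (c * b - b * c) + (2 : k) • (a * b - b * a) := by
      simp only [two_smul]
      noncomm_ring
    rw [this, he, hf, hef]
    simp only [two_smul]
    abel
  convert h3 using 1
  simp only [two_smul, neg_smul, one_smul]
  abel

/-- An eigenvector of `h` with eigenvalue `n` is carried into the eigenspace for `-n` by a suitable
product of powers of `e` and `f`. -/
lemma exists_pow_pow_ne_zero (t : IsSl2Triple h e f) {v : M} (hv : v ≠ 0) {c : k}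
    (hc : ⁅h, v⁆ = c • v) : ∃ n : ℤ, c = n ∧
      ((∃ i j : ℕ, (j : ℤ) = i + n ∧ (toEnd k L M f ^ j) ((toEnd k L M e ^ i) v) ≠ 0) ∨
        ∃ i j : ℕ, (j : ℤ) = i - n ∧ (toEnd k L M e ^ j) ((toEnd k L M f ^ i) v) ≠ 0) := by
  have prim : ∀ {h e f : L} (t : IsSl2Triple h e f) {c : k}, ⁅h, v⁆ = c • v →
      ∃ i m : ℕ, c + 2 * i = m ∧
        ∀ j ≤ m, (toEnd k L M f ^ j) ((toEnd k L M e ^ i) v) ≠ 0 := by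
    intro h e f t c hc
    have hex : ∃ n : ℕ, (toEnd k L M e ^ n) v = 0 := by
      by_contra! hne
      have hli := Module.End.eigenvectors_linearIndependent' (toEnd k L M h)
        (fun n : ℕ => c + (2 * n : k)) (fun a b hab => by simpa using hab)
        (fun n => (toEnd k L M e ^ n) v) (fun n =>
          ⟨by rw [Module.End.mem_eigenspace_iff]; exact t.lie_h_pow_toEnd_e hc n, hne n⟩)
      exact not_finite_iff_infinite.mpr inferInstance hli.finite
    obtain ⟨i, hi, hi'⟩ := Nat.exists_not_and_succ_of_not_zero_of_exists (by simpa using hv) hex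
    have P : HasPrimitiveVectorWith t ((toEnd k L M e ^ i) v) (c + 2 * i) :=
      ⟨hi, t.lie_h_pow_toEnd_e hc i, by rwa [lie_e_pow_toEnd_e]⟩
    obtain ⟨m, hm⟩ := P.exists_nat
    exact ⟨i, m, hm, fun j hj => P.pow_toEnd_f_ne_zero_of_eq_nat hm hj⟩
  obtain ⟨i, m, him, hi⟩ := prim t hc
  obtain ⟨i', m', him', hi'⟩ := prim (c := -c) t.symm (by rw [neg_lie, hc, neg_smul])
  refine ⟨m - 2 * i, by push_cast; rw [← him]; ring, ?_⟩
  have hmm : (m' : ℤ) - 2 * i' = -(m - 2 * i) := by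
    have : ((m' : k) - 2 * i') = -(m - 2 * i) := by rw [← him, ← him']; ring
    exact_mod_cast this
  rcases le_total 0 ((m : ℤ) - 2 * i) with h0 | h0
  · exact Or.inl ⟨i, m - i, by omega, hi _ (by omega)⟩
  · exact Or.inr ⟨i', m' - i', by omega, hi' _ (by omega)⟩

end IsSl2Triple

/-! ### Reflections and root systems from a bilinear form -/

section Reflection

variable {k V : Type*} [Field k] [AddCommGroup V] [Module k V] {Q : LinearMap.BilinForm k V}

lemma formReflection_apply (a v : V) :
    formReflection Q a v = v - (2 * Q a v / Q a a) • a := by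
  simp only [formReflection, LinearMap.sub_apply, LinearMap.id_apply, LinearMap.smulRight_apply,
    LinearMap.smul_apply, smul_eq_mul]
  congr 2
  ring

lemma formReflection_formReflection {a : V} (ha : Q a a ≠ 0) (v : V) :
    formReflection Q a (formReflection Q a v) = v := by
  rw [formReflection_apply, formReflection_apply, map_sub, map_smul, smul_eq_mul,
    div_mul_cancel₀ _ ha, sub_sub, ← add_smul, ← add_div]
  ring_nf
  rw [zero_smul, sub_zero]

lemma sub_smul_ne_zero {a v : V} (ha : Q a a ≠ 0) (hv : v ≠ 0) :
    v - (2 * Q a v / Q a a) • a ≠ 0 := by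
  rw [← formReflection_apply]
  intro h0
  rw [← formReflection_formReflection ha v, h0, map_zero] at hv
  exact hv rfl

/-- A set stable under the orthogonal reflections in the elements of `Φ` is invariant under the
group generated by them. -/
lemma image_eq_of_mem_formWeylGroup {Φ S : Set V} (hne : ∀ a ∈ Φ, Q a a ≠ 0)
    (hS : ∀ a ∈ Φ, ∀ b ∈ S, formReflection Q a b ∈ S) {w : V ≃ₗ[k] V}
    (hw : w ∈ formWeylGroup Q Φ) : (fun a => w a) '' S = S := by
  induction hw using Subgroup.closure_induction with
  | mem g hg =>
    obtain ⟨a, ha, hga⟩ := hg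
    have hg' : ∀ v, g v = formReflection Q a v := LinearMap.congr_fun hga
    simp only [hg']
    refine Set.Subset.antisymm ?_ fun b hb =>
      ⟨_, hS a ha b hb, formReflection_formReflection (hne a ha) b⟩
    rintro _ ⟨b, hb, rfl⟩
    exact hS a ha b hb
  | one => exact Set.image_id S
  | mul g g' _ _ h h' =>
    conv_rhs => rw [← h, ← h', Set.image_image]
    rfl
  | inv g _ h =>
    conv_lhs => rw [← h, Set.image_image]
    exact (Set.image_congr fun a _ => g.symm_apply_apply a).trans (Set.image_id S)

end Reflection

section FormRootSystem

variable {k V : Type*} [Field k] [CharZero k] [AddCommGroup V] [Module k V]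
  {Q : LinearMap.BilinForm k V} {Φ : Set V}

theorem isFormRootSystem_of_reflection_mem [FiniteDimensional k V] (hfin : Φ.Finite)
    (hne : ∀ a ∈ Φ, Q a a ≠ 0)
    (hint : ∀ a ∈ Φ, ∀ b ∈ Φ, ∃ n : ℤ, 2 * Q a b / Q a a = n)
    (hmem : ∀ a ∈ Φ, ∀ b ∈ Φ, b - (2 * Q a b / Q a a) • a ∈ Φ) : IsFormRootSystem Q Φ := by
  refine ⟨hfin, ?_⟩
  have : Finite Φ := hfin
  have : IsAddTorsionFree V := .of_isTorsionFree k V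
  let c : V → Dual k V := fun a => (2 / Q a a) • Q a
  have hc : ∀ a x, c a x = 2 * Q a x / Q a a := fun a x => by
    simp only [c, LinearMap.smul_apply, smul_eq_mul]; ring
  have hc2 : ∀ a ∈ Φ, c a a = 2 := fun a ha => by
    rw [hc, mul_div_assoc, div_self (hne a ha), mul_one]
  have hmaps : ∀ a ∈ Φ, Set.MapsTo (preReflection a (c a)) Φ Φ := fun a ha b hb => by
    rw [preReflection_apply, hc]; exact hmem a ha b hb
  let root : Φ ↪ span k Φ :=
    ⟨fun a => ⟨a, subset_span a.2⟩, fun a b h => Subtype.ext (congrArg (Subtype.val (p := (· ∈ span k Φ))) h)⟩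
  -- distinct elements of the finite set `Φ` have distinct coroots
  let coroot : Φ ↪ Dual k (span k Φ) :=
    ⟨fun a => (c a).domRestrict (span k Φ), fun a b h => by
      have h' : ∀ x ∈ Φ, c a x = c b x := fun x hx =>
        LinearMap.congr_fun h (⟨x, subset_span hx⟩ : span k Φ)
      exact Subtype.ext <| eq_of_mapsTo_reflection_of_mem hfin (hc2 a a.2) (hc2 b b.2)
        ((h' a a.2).symm.trans (hc2 a a.2)) ((h' b b.2).trans (hc2 b b.2))
        (hmaps a a.2) (hmaps b b.2) b.2⟩
  have hp : ∀ a, Dual.eval k (span k Φ) (root a) (coroot a) = 2 := fun a => hc2 a a.2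
  have hs : ∀ a, Set.MapsTo (preReflection (root a) ((Dual.eval k (span k Φ)).flip (coroot a)))
      (Set.range root) (Set.range root) := by
    rintro a _ ⟨b, rfl⟩
    exact ⟨⟨_, hmaps a a.2 b.2⟩, Subtype.ext rfl⟩
  have hsp : span k (Set.range root) = ⊤ := by
    have : Set.range root = ((↑) : span k Φ → V) ⁻¹' Φ := by
      ext x
      exact ⟨by rintro ⟨a, rfl⟩; exact a.2, fun hx => ⟨⟨x, hx⟩, rfl⟩⟩
    rw [this, span_span_coe_preimage]
  have hz : ∀ a b, ∃ z : ℤ, z = Dual.eval k (span k Φ) (root a) (coroot b) := fun a b => by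
    obtain ⟨n, hn⟩ := hint b b.2 a a.2
    exact ⟨n, hn.symm.trans (hc b a).symm⟩
  exact ⟨RootPairing.mk'' _ root coroot hp hs hsp, RootPairing.isRootSystem_mk'' hz, ⟨hz⟩,
    fun _ _ => rfl, fun _ => rfl, fun a x => hc a x⟩

/-- In a root system, the Cartan number of two roots of equal length is `2` only if the roots are
equal and `-2` only if they are opposite; otherwise it is `-1`, `0` or `1`. -/
theorem IsFormRootSystem.cartan_number_of_length_eq (h : IsFormRootSystem Q Φ) {a b : V}
    (ha : a ∈ Φ) (hb : b ∈ Φ) (hab : Q a a = Q b b) (hsymm : Q a b = Q b a) :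
    a = b ∨ a = -b ∨ 2 * Q a b / Q a a = 1 ∨ 2 * Q a b / Q a a = 0 ∨
      2 * Q a b / Q a a = -1 := by
  obtain ⟨hfin, P, hP, hcr, hev, hroot, hcoroot⟩ := h
  have : Finite Φ := hfin
  have hpair : ∀ i j : Φ, P.pairing i j = 2 * Q j i / Q j j := fun i j => by
    rw [RootPairing.pairing, RootPairing.root']
    have := hev (P.root i) (P.coroot j)
    rw [hcoroot, hroot] at this
    exact this
  have hZ : ∀ i j : Φ, ((P.pairingIn ℤ i j : ℤ) : k) = 2 * Q j i / Q j j := fun i j => by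
    rw [← hpair]; exact P.algebraMap_pairingIn ℤ i j
  have heq : P.pairingIn ℤ ⟨a, ha⟩ ⟨b, hb⟩ = P.pairingIn ℤ ⟨b, hb⟩ ⟨a, ha⟩ := by
    have : ((P.pairingIn ℤ ⟨a, ha⟩ ⟨b, hb⟩ : ℤ) : k) = (P.pairingIn ℤ ⟨b, hb⟩ ⟨a, ha⟩ : ℤ) := by
      rw [hZ, hZ, ← hab, hsymm]
    exact_mod_cast this
  have hba := hZ ⟨b, hb⟩ ⟨a, ha⟩
  have hmem := P.pairingIn_pairingIn_mem_set_of_isCrystallographic ⟨b, hb⟩ ⟨a, ha⟩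
  rw [heq] at hmem
  have h5 : ∀ z : ℤ, (z, z) ∈ ({(0, 0), (1, 1), (-1, -1), (1, 2), (2, 1), (-1, -2), (-2, -1),
      (1, 3), (3, 1), (-1, -3), (-3, -1), (4, 1), (1, 4), (-4, -1), (-1, -4), (2, 2),
      (-2, -2)} : Set (ℤ × ℤ)) → z = 2 ∨ z = -2 ∨ z = 1 ∨ z = 0 ∨ z = -1 := by
    intro z hz
    simp only [Set.mem_insert_iff, Set.mem_singleton_iff, Prod.mk.injEq] at hz
    omega
  rcases h5 _ hmem with h | h | h | h | h
  · left
    exact congrArg Subtype.val ((P.pairingIn_two_two_iff ℤ _ _).mp ⟨heq.trans h, h⟩)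
  · right; left
    have := (P.pairingIn_neg_two_neg_two_iff ℤ _ _).mp ⟨heq.trans h, h⟩
    simpa [hroot] using congrArg (fun x : span k Φ => (x : V)) this
  all_goals
    rw [h] at hba
    simp only [← hba]
    simp

end FormRootSystem

/-! ### Weight spaces of toral subalgebras -/

namespace LieSuperalgebra

section Weights

variable {k L₀ V : Type*} [Field k] [LieRing L₀] [LieAlgebra k L₀]
  [AddCommGroup V] [Module k V] [LieRingModule L₀ V] [LieModule k L₀ V]
  {𝔥 : LieSubalgebra k L₀}

variable (V) in
/-- The space of weight vectors of weight `χ` for the action of `𝔥` on `V` (proper, not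
generalized, eigenvectors). -/
def wtSpace (χ : Dual k 𝔥) : Submodule k V where
  carrier := {v | ∀ t : 𝔥, ⁅(t : L₀), v⁆ = χ t • v}
  add_mem' := fun hu hv t => by rw [lie_add, hu t, hv t, smul_add]
  zero_mem' := fun t => by simp
  smul_mem' := fun c v hv t => by rw [lie_smul, hv t, smul_comm]

lemma lie_mem_wtSpace {χ ψ : Dual k 𝔥} {x : L₀} (hx : x ∈ wtSpace L₀ χ) {v : V}
    (hv : v ∈ wtSpace V ψ) : ⁅x, v⁆ ∈ wtSpace V (χ + ψ) := fun t => by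
  rw [leibniz_lie, hx t, hv t, smul_lie, lie_smul, ← add_smul, LinearMap.add_apply]

lemma toEnd_pow_mem_wtSpace {χ ψ : Dual k 𝔥} {x : L₀} (hx : x ∈ wtSpace L₀ χ) {v : V}
    (hv : v ∈ wtSpace V ψ) (n : ℕ) :
    (LieModule.toEnd k L₀ V x ^ n) v ∈ wtSpace V (ψ + (n : k) • χ) := by
  induction n with
  | zero => simpa using hv
  | succ n ih =>
    rw [pow_succ', Module.End.mul_apply, LieModule.toEnd_apply_apply]
    convert lie_mem_wtSpace hx ih using 2
    push_cast
    module

lemma wtSpace_le_iInf_maxGenEigenspace (χ : Dual k 𝔥) :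
    wtSpace V χ ≤ ⨅ t : 𝔥, (LieModule.toEnd k L₀ V t).maxGenEigenspace (χ t) := by
  refine le_iInf fun t v hv => ?_
  exact (LieModule.toEnd k L₀ V t).genEigenspace (χ t) |>.mono (OrderTop.le_top _)
    (Module.End.mem_eigenspace_iff.mpr (hv t))

lemma commute_toEnd (hab : ∀ x ∈ 𝔥, ∀ y ∈ 𝔥, ⁅x, y⁆ = 0) (s t : 𝔥) :
    Commute (LieModule.toEnd k L₀ V s) (LieModule.toEnd k L₀ V t) := by
  refine LinearMap.ext fun v => ?_
  have := lie_lie (s : L₀) (t : L₀) v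
  rw [hab s s.2 t t.2, zero_lie] at this
  exact (sub_eq_zero.mp this.symm)

theorem finite_setOf_wtSpace_ne_bot [FiniteDimensional k V]
    (hab : ∀ x ∈ 𝔥, ∀ y ∈ 𝔥, ⁅x, y⁆ = 0) : {χ : Dual k 𝔥 | wtSpace V χ ≠ ⊥}.Finite := by
  have h1 := Module.End.independent_iInf_maxGenEigenspace_of_forall_mapsTo
    (fun t : 𝔥 => LieModule.toEnd k L₀ V t)
    (fun s t φ => Module.End.mapsTo_maxGenEigenspace_of_comm (commute_toEnd hab t s) φ)
  have h2 : iSupIndep fun χ : Dual k 𝔥 => wtSpace V χ :=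
    (h1.comp DFunLike.coe_injective).mono fun χ => wtSpace_le_iInf_maxGenEigenspace χ
  exact WellFoundedGT.finite_ne_bot_of_iSupIndep h2

theorem iSup_wtSpace_eq_top [IsAlgClosed k] [FiniteDimensional k V]
    (hab : ∀ x ∈ 𝔥, ∀ y ∈ 𝔥, ⁅x, y⁆ = 0)
    (hss : ∀ x ∈ 𝔥, (LieModule.toEnd k L₀ V x).IsSemisimple) :
    ⨆ χ : Dual k 𝔥, wtSpace V χ = ⊤ := by
  have h1 := Module.End.iSup_iInf_maxGenEigenspace_eq_top_of_iSup_maxGenEigenspace_eq_top_of_commute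
    (fun t : 𝔥 => LieModule.toEnd k L₀ V t) (fun s t _ => commute_toEnd hab s t)
    (fun t => Module.End.iSup_maxGenEigenspace_eq_top _)
  rw [eq_top_iff, ← h1, iSup_le_iff]
  intro χ v hv
  rcases eq_or_ne v 0 with rfl | hv0
  · exact zero_mem _
  have hχ : ∀ t : 𝔥, ⁅(t : L₀), v⁆ = χ t • v := fun t => by
    have := (Submodule.mem_iInf _).mp hv t
    rw [(hss t t.2).isFinitelySemisimple.maxGenEigenspace_eq_eigenspace,
      Module.End.mem_eigenspace_iff] at this
    exact this
  have hinj := smul_left_injective k hv0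
  let χ' : Dual k 𝔥 :=
    { toFun := χ
      map_add' := fun s t => hinj (by
        change χ (s + t) • v = (χ s + χ t) • v
        rw [add_smul, ← hχ, ← hχ, ← hχ, ← add_lie]; rfl)
      map_smul' := fun c t => hinj (by
        change χ (c • t) • v = (c * χ t) • v
        rw [mul_smul, ← hχ, ← hχ, ← smul_lie]; rfl) }
  exact Submodule.mem_iSup_of_mem χ' hχ

/-- Under an invariant form with trivial left kernel, the weight spaces for `χ` and `-χ` are in
duality, since those for `χ` and `ψ ≠ -χ` are orthogonal. -/
theorem exists_mem_wtSpace_neg_apply_ne_zero (hsup : ⨆ χ : Dual k 𝔥, wtSpace V χ = ⊤)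
    {b : LinearMap.BilinForm k V} (hb : ∀ (t : L₀) (u v : V), b ⁅t, u⁆ v = -b u ⁅t, v⁆)
    (hsep : b.SeparatingLeft) {χ : Dual k 𝔥} {u : V} (hu : u ∈ wtSpace V χ) (hu0 : u ≠ 0) :
    ∃ v ∈ wtSpace V (-χ), b u v ≠ 0 := by
  by_contra! h
  refine hu0 (hsep u fun v => ?_)
  have hle : ⨆ ψ : Dual k 𝔥, wtSpace V ψ ≤ LinearMap.ker (b u) := by
    refine iSup_le fun ψ v hv => ?_
    rw [LinearMap.mem_ker]
    by_cases hψ : ψ = -χ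
    · exact h v (hψ ▸ hv)
    · obtain ⟨t, ht⟩ : ∃ t, ψ t ≠ -χ t := by
        by_contra! h'
        exact hψ (LinearMap.ext h')
      have := hb t u v
      rw [hu t, hv t, map_smul, map_smul, LinearMap.smul_apply, smul_eq_mul, smul_eq_mul,
        ← neg_mul, ← sub_eq_zero, ← sub_mul, mul_eq_zero] at this
      refine this.resolve_left fun h' => ht ?_
      linear_combination h'
  exact hle (hsup ▸ Submodule.mem_top)

/-- The zero weight space of a self-normalizing subalgebra lies in that subalgebra. -/
lemma mem_of_mem_wtSpace_zero [𝔥.IsCartanSubalgebra] {x : L₀}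
    (hx : x ∈ wtSpace L₀ (0 : Dual k 𝔥)) : x ∈ 𝔥 := by
  rw [← LieSubalgebra.IsCartanSubalgebra.self_normalizing (H := 𝔥),
    LieSubalgebra.mem_normalizer_iff]
  intro y hy
  rw [← lie_skew, hx ⟨y, hy⟩]
  simp

end Weights

/-! ### Roots of a Lie superalgebra with an invariant form -/

section Super

variable {k L₀ L₁ : Type*} [Field k] [LieRing L₀] [LieAlgebra k L₀]
  [AddCommGroup L₁] [Module k L₁] [LieRingModule L₀ L₁] [LieModule k L₀ L₁]
  {𝔥 : LieSubalgebra k L₀}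

variable (L₁) in
/-- `χ` is a weight of `𝔥`, possibly zero, on the even or on the odd part of the superalgebra. -/
def IsWeight (χ : Dual k 𝔥) : Prop :=
  (∃ x : L₀, x ≠ 0 ∧ x ∈ wtSpace L₀ χ) ∨ ∃ u : L₁, u ≠ 0 ∧ u ∈ wtSpace L₁ χ

theorem finite_roots [FiniteDimensional k L₀] [FiniteDimensional k L₁] (ht : IsToral L₁ 𝔥) :
    (roots L₁ 𝔥).Finite := by
  refine ((finite_setOf_wtSpace_ne_bot (V := L₀) ht.lie_eq_zero).union
    (finite_setOf_wtSpace_ne_bot (V := L₁) ht.lie_eq_zero)).subset ?_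
  rintro χ ⟨-, ⟨x, hx0, hx⟩ | ⟨x, hx0, hx⟩⟩
  · exact Or.inl ((Submodule.ne_bot_iff _).mpr ⟨x, hx, hx0⟩)
  · exact Or.inr ((Submodule.ne_bot_iff _).mpr ⟨x, hx, hx0⟩)

variable [LieSuperalgebra k L₀ L₁]

lemma oddBracket_mem_wtSpace {χ ψ : Dual k 𝔥} {u v : L₁} (hu : u ∈ wtSpace L₁ χ)
    (hv : v ∈ wtSpace L₁ ψ) : oddBracket (k := k) (L₀ := L₀) u v ∈ wtSpace L₀ (χ + ψ) :=
  fun t => by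
    rw [even_odd_odd, hu t, hv t, map_smul, map_smul, LinearMap.smul_apply, ← add_smul,
      LinearMap.add_apply]

variable (B : InvariantForm k L₀ L₁)

lemma InvariantForm.even_lie_left (x y z : L₀) : B.even ⁅x, y⁆ z = -B.even y ⁅x, z⁆ := by
  rw [← lie_skew, map_neg, LinearMap.neg_apply, B.invariant_even]

lemma InvariantForm.odd_lie_left (x : L₀) (u v : L₁) : B.odd ⁅x, u⁆ v = -B.odd u ⁅x, v⁆ := by
  rw [B.invariant_odd, oddBracket_symm, ← B.invariant_odd, B.odd_skew]

section Toral

variable [IsAlgClosed k] (ht : IsToral L₁ 𝔥)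
include ht

theorem exists_even_dual [FiniteDimensional k L₀] {χ : Dual k 𝔥} {x : L₀} (hx : x ∈ wtSpace L₀ χ) (hx0 : x ≠ 0) :
    ∃ y ∈ wtSpace L₀ (-χ), B.even x y ≠ 0 :=
  exists_mem_wtSpace_neg_apply_ne_zero (iSup_wtSpace_eq_top ht.lie_eq_zero ht.semisimple_even)
    B.even_lie_left B.even_nondegenerate.1 hx hx0

theorem exists_odd_dual [FiniteDimensional k L₁] {χ : Dual k 𝔥} {u : L₁} (hu : u ∈ wtSpace L₁ χ) (hu0 : u ≠ 0) :
    ∃ v ∈ wtSpace L₁ (-χ), B.odd u v ≠ 0 :=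
  exists_mem_wtSpace_neg_apply_ne_zero (iSup_wtSpace_eq_top ht.lie_eq_zero ht.semisimple_odd)
    B.odd_lie_left B.odd_nondegenerate.1 hu hu0

variable [FiniteDimensional k L₀]

include B in
theorem neg_mem_roots [FiniteDimensional k L₁] {χ : Dual k 𝔥} (hχ : χ ∈ roots L₁ 𝔥) : -χ ∈ roots L₁ 𝔥 := by
  obtain ⟨h0, ⟨x, hx0, hx⟩ | ⟨x, hx0, hx⟩⟩ := hχ
  · obtain ⟨y, hy, hxy⟩ := exists_even_dual B ht hx hx0
    exact ⟨neg_ne_zero.mpr h0, Or.inl ⟨y, by rintro rfl; simp at hxy, hy⟩⟩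
  · obtain ⟨y, hy, hxy⟩ := exists_odd_dual B ht hx hx0
    exact ⟨neg_ne_zero.mpr h0, Or.inr ⟨y, by rintro rfl; simp at hxy, hy⟩⟩

theorem restrict_nondegenerate_of_isCartanSubalgebra [𝔥.IsCartanSubalgebra] :
    (B.restrict 𝔥).Nondegenerate := by
  have key : ∀ t : 𝔥, (∀ s : 𝔥, B.even t s = 0) → t = 0 := by
    intro t h
    by_contra ht0
    have hmem : (t : L₀) ∈ wtSpace L₀ (0 : Dual k 𝔥) := fun s => by
      rw [ht.lie_eq_zero s s.2 t t.2, LinearMap.zero_apply, zero_smul]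
    obtain ⟨y, hy, hty⟩ := exists_even_dual B ht hmem (fun h' => ht0 (Subtype.ext h'))
    rw [neg_zero] at hy
    exact hty (h ⟨y, mem_of_mem_wtSpace_zero hy⟩)
  refine ⟨fun t h => key t h, fun t h => key t fun s => ?_⟩
  rw [B.even_symm]
  exact h s

end Toral

section DualVec

variable {𝔟 : LieSubalgebra k L₀} (hnd : (B.restrict 𝔟).Nondegenerate)

include hnd in
lemma eq_of_even_eq {s t : 𝔟} (h : ∀ r : 𝔟, B.even s r = B.even t r) : s = t := by
  rw [← sub_eq_zero]
  refine hnd.1 _ fun r => ?_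
  rw [map_sub, LinearMap.sub_apply, sub_eq_zero]
  exact h r

variable [FiniteDimensional k L₀]

variable {B} in
/-- The element of `𝔟` that represents the linear form `χ` via the invariant form. -/
noncomputable def dualVec (χ : Dual k 𝔟) : 𝔟 := ((B.restrict 𝔟).toDual hnd).symm χ

lemma even_dualVec (χ : Dual k 𝔟) (s : 𝔟) : B.even (dualVec hnd χ) s = χ s :=
  LinearMap.BilinForm.apply_toDual_symm_apply (hB := hnd) (f := χ) s

lemma onDual_apply (χ ψ : Dual k 𝔟) : B.onDual 𝔟 χ ψ = ψ (dualVec hnd χ) := by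
  have h : B.onDual 𝔟 χ ψ = B.even (dualVec hnd χ) (dualVec hnd ψ) := by
    rw [InvariantForm.onDual, dualForm, dif_pos hnd]
    rfl
  rw [h, B.even_symm, even_dualVec]

include hnd in
lemma onDual_symm (χ ψ : Dual k 𝔟) : B.onDual 𝔟 χ ψ = B.onDual 𝔟 ψ χ := by
  rw [onDual_apply B hnd, onDual_apply B hnd, ← even_dualVec B hnd, ← even_dualVec B hnd,
    B.even_symm]

include hnd in
lemma onDual_nondegenerate : (B.onDual 𝔟).Nondegenerate := by
  have key : ∀ χ : Dual k 𝔟, (∀ ψ, B.onDual 𝔟 χ ψ = 0) → χ = 0 := by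
    intro χ h
    have h0 : dualVec hnd χ = 0 := by
      rw [← Module.forall_dual_apply_eq_zero_iff k]
      intro ψ
      rw [← onDual_apply B hnd, h]
    ext s
    rw [← even_dualVec B hnd, h0]
    simp
  exact ⟨key, fun χ h => key χ fun ψ => by rw [onDual_symm B hnd, h]⟩

end DualVec

section Cartan

variable [FiniteDimensional k L₀] (hnd : (B.restrict 𝔥).Nondegenerate)

include hnd in
lemma onDual_reflection_self {α : Dual k 𝔥} (h : B.onDual 𝔥 α α ≠ 0) (β : Dual k 𝔥) :
    B.onDual 𝔥 (β - (2 * B.onDual 𝔥 α β / B.onDual 𝔥 α α) • α)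
      (β - (2 * B.onDual 𝔥 α β / B.onDual 𝔥 α α) • α) = B.onDual 𝔥 β β := by
  simp only [map_sub, map_smul, LinearMap.sub_apply, LinearMap.smul_apply, smul_eq_mul]
  rw [onDual_symm B hnd β α]
  field_simp
  ring

variable [𝔥.IsCartanSubalgebra]

theorem lie_eq_smul_dualVec {α : Dual k 𝔥} {x y : L₀} (hx : x ∈ wtSpace L₀ α)
    (hy : y ∈ wtSpace L₀ (-α)) : ⁅x, y⁆ = B.even x y • (dualVec hnd α : L₀) := by
  have h0 : ⁅x, y⁆ ∈ wtSpace L₀ (0 : Dual k 𝔥) := by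
    simpa using lie_mem_wtSpace hx hy
  have hmem := mem_of_mem_wtSpace_zero h0
  have : (⟨⁅x, y⁆, hmem⟩ : 𝔥) = B.even x y • dualVec hnd α := by
    refine eq_of_even_eq B hnd fun r => ?_
    change B.even ⁅x, y⁆ r = B.even (B.even x y • (dualVec hnd α : L₀)) r
    rw [B.even_symm, ← B.invariant_even, hx r, map_smul, map_smul, LinearMap.smul_apply,
      LinearMap.smul_apply, even_dualVec, smul_eq_mul, smul_eq_mul, mul_comm]
  exact congrArg Subtype.val this

theorem oddBracket_eq_smul_dualVec {α : Dual k 𝔥} {u v : L₁} (hu : u ∈ wtSpace L₁ α)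
    (hv : v ∈ wtSpace L₁ (-α)) :
    oddBracket (k := k) (L₀ := L₀) u v = B.odd u v • (dualVec hnd α : L₀) := by
  have h0 : oddBracket (k := k) (L₀ := L₀) u v ∈ wtSpace L₀ (0 : Dual k 𝔥) := by
    simpa using oddBracket_mem_wtSpace hu hv
  have hmem := mem_of_mem_wtSpace_zero h0
  have : (⟨oddBracket (k := k) u v, hmem⟩ : 𝔥) = B.odd u v • dualVec hnd α := by
    refine eq_of_even_eq B hnd fun r => ?_
    change B.even (oddBracket (k := k) u v) r = B.even (B.odd u v • (dualVec hnd α : L₀)) r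
    rw [B.even_symm, ← B.invariant_odd, hu r, map_smul, map_smul, LinearMap.smul_apply,
      LinearMap.smul_apply, even_dualVec, smul_eq_mul, smul_eq_mul, mul_comm]
  exact congrArg Subtype.val this

theorem isSl2Triple_of_nonisotropic [CharZero k] {α : Dual k 𝔥} (h : B.onDual 𝔥 α α ≠ 0) {x y : L₀}
    (hx : x ∈ wtSpace L₀ α) (hy : y ∈ wtSpace L₀ (-α)) (hxy : B.even x y ≠ 0) :
    IsSl2Triple ((2 / B.onDual 𝔥 α α) • (dualVec hnd α : L₀)) x
      ((2 / (B.onDual 𝔥 α α * B.even x y)) • y) := by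
  have hα := onDual_apply B hnd α α
  refine ⟨?_, ?_, ?_, ?_⟩
  · refine smul_ne_zero (div_ne_zero two_ne_zero h) fun h0 => h ?_
    rw [hα, show dualVec hnd α = 0 from Subtype.ext h0, map_zero]
  · rw [lie_smul, lie_eq_smul_dualVec B hnd hx hy, smul_smul]
    congr 1
    field_simp
  · rw [smul_lie, hx, smul_smul, ← hα, div_mul_cancel₀ _ h, two_smul, two_nsmul]
  · rw [smul_lie, lie_smul, hy, LinearMap.neg_apply, ← hα, ← Nat.cast_smul_eq_nsmul k, smul_smul,
      smul_smul, smul_smul, ← neg_smul]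
    congr 1
    push_cast
    field_simp

variable [IsAlgClosed k] (ht : IsToral L₁ 𝔥)
include ht hnd

/-- If `(α, β) ≠ 0`, then `[x, y]` for dual root vectors `x`, `y` of `α`, `-α` acts on the weight
space of `β` by a nonzero scalar, so that `x` or `y` does not annihilate it. -/
theorem isWeight_add_or_sub [FiniteDimensional k L₁] {α β : Dual k 𝔥} (hα : IsWeight L₁ α) (hβ : IsWeight L₁ β)
    (h : B.onDual 𝔥 α β ≠ 0) : IsWeight L₁ (β + α) ∨ IsWeight L₁ (β - α) := by
  rw [onDual_apply B hnd] at h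
  rw [add_comm β, sub_eq_neg_add]
  obtain ⟨x, hx0, hx⟩ | ⟨u, hu0, hu⟩ := hα
  · obtain ⟨y, hy, hxy⟩ := exists_even_dual B ht hx hx0
    have hb := lie_eq_smul_dualVec B hnd hx hy
    obtain ⟨z, hz0, hz⟩ | ⟨z, hz0, hz⟩ := hβ
    · have hne : ⁅⁅x, y⁆, z⁆ ≠ 0 := by
        rw [hb, smul_lie, hz]; exact smul_ne_zero hxy (smul_ne_zero h hz0)
      rw [lie_lie] at hne
      by_cases h1 : ⁅x, z⁆ = 0
      · refine Or.inr (Or.inl ⟨⁅y, z⁆, fun h2 => ?_, lie_mem_wtSpace hy hz⟩)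
        simp [h1, h2] at hne
      · exact Or.inl (Or.inl ⟨_, h1, lie_mem_wtSpace hx hz⟩)
    · have hne : ⁅⁅x, y⁆, z⁆ ≠ 0 := by
        rw [hb, smul_lie, hz]; exact smul_ne_zero hxy (smul_ne_zero h hz0)
      rw [lie_lie] at hne
      by_cases h1 : ⁅x, z⁆ = 0
      · refine Or.inr (Or.inr ⟨⁅y, z⁆, fun h2 => ?_, lie_mem_wtSpace hy hz⟩)
        simp [h1, h2] at hne
      · exact Or.inl (Or.inr ⟨_, h1, lie_mem_wtSpace hx hz⟩)
  · obtain ⟨v, hv, huv⟩ := exists_odd_dual B ht hu hu0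
    have hb := oddBracket_eq_smul_dualVec B hnd hu hv
    obtain ⟨z, hz0, hz⟩ | ⟨z, hz0, hz⟩ := hβ
    · have hne : ⁅z, oddBracket (k := k) (L₀ := L₀) u v⁆ ≠ 0 := by
        rw [← lie_skew, hb, smul_lie, hz]
        exact neg_ne_zero.mpr (smul_ne_zero huv (smul_ne_zero h hz0))
      rw [even_odd_odd] at hne
      by_cases h1 : ⁅z, u⁆ = 0
      · refine Or.inr (Or.inr ⟨⁅z, v⁆, fun h2 => ?_, ?_⟩)
        · simp [h1, h2] at hne
        · rw [add_comm]; exact lie_mem_wtSpace hz hv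
      · refine Or.inl (Or.inr ⟨_, h1, ?_⟩)
        rw [add_comm]; exact lie_mem_wtSpace hz hu
    · have hne : ⁅oddBracket (k := k) (L₀ := L₀) u v, z⁆ ≠ 0 := by
        rw [hb, smul_lie, hz]; exact smul_ne_zero huv (smul_ne_zero h hz0)
      have hJ := odd_odd_odd (k := k) (L₀ := L₀) u v z
      by_cases h1 : oddBracket (k := k) (L₀ := L₀) z u = 0
      · refine Or.inr (Or.inl ⟨oddBracket (k := k) v z, fun h2 => ?_,
          oddBracket_mem_wtSpace hv hz⟩)
        exact hne (by simpa [h1, h2] using hJ)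
      · refine Or.inl (Or.inl ⟨_, h1, ?_⟩)
        rw [add_comm]; exact oddBracket_mem_wtSpace hz hu

variable [CharZero k]

/-- Twice a nonisotropic odd root is an even root. -/
theorem exists_even_of_odd_nonisotropic [FiniteDimensional k L₁] {α : Dual k 𝔥} (h : B.onDual 𝔥 α α ≠ 0) {u : L₁}
    (hu0 : u ≠ 0) (hu : u ∈ wtSpace L₁ α) : ∃ x : L₀, x ≠ 0 ∧ x ∈ wtSpace L₀ (α + α) := by
  rw [onDual_apply B hnd] at h
  obtain ⟨v, hv, huv⟩ := exists_odd_dual B ht hu hu0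
  refine ⟨oddBracket (k := k) u u, fun h0 => ?_, oddBracket_mem_wtSpace hu hu⟩
  have hJ := odd_odd_odd (k := k) (L₀ := L₀) u u v
  rw [h0, zero_lie, zero_add, oddBracket_symm v u, ← two_smul k,
    oddBracket_eq_smul_dualVec B hnd hu hv, smul_lie, hu] at hJ
  exact smul_ne_zero two_ne_zero (smul_ne_zero huv (smul_ne_zero h hu0)) hJ

/-- The action of the reflection in a nonisotropic even root `α` on the weights of a module: it
comes from the action of an `sl₂`-triple with `e` in the root space of `α`. -/
theorem even_reflection {V : Type*} [AddCommGroup V] [Module k V] [LieRingModule L₀ V]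
    [LieModule k L₀ V] [FiniteDimensional k V] {α β : Dual k 𝔥} (h : B.onDual 𝔥 α α ≠ 0)
    {x : L₀} (hx0 : x ≠ 0) (hx : x ∈ wtSpace L₀ α) {v : V} (hv0 : v ≠ 0)
    (hv : v ∈ wtSpace V β) :
    ∃ n : ℤ, 2 * B.onDual 𝔥 α β / B.onDual 𝔥 α α = n ∧
      ∃ w : V, w ≠ 0 ∧ w ∈ wtSpace V (β - (n : k) • α) := by
  obtain ⟨y, hy, hxy⟩ := exists_even_dual B ht hx hx0
  have t := isSl2Triple_of_nonisotropic B hnd h hx hy hxy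
  have hf := (wtSpace L₀ (-α)).smul_mem (2 / (B.onDual 𝔥 α α * B.even x y)) hy
  have hc : ⁅(2 / B.onDual 𝔥 α α) • (dualVec hnd α : L₀), v⁆
      = (2 * B.onDual 𝔥 α β / B.onDual 𝔥 α α) • v := by
    rw [smul_lie, hv, smul_smul, onDual_apply B hnd α β]
    congr 1
    ring
  obtain ⟨n, hn, ⟨i, j, hij, hw⟩ | ⟨i, j, hij, hw⟩⟩ := t.exists_pow_pow_ne_zero hv0 hc
  · have hij' : (j : k) = i + n := by exact_mod_cast congrArg (Int.cast (R := k)) hij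
    refine ⟨n, hn, _, hw, ?_⟩
    convert toEnd_pow_mem_wtSpace hf (toEnd_pow_mem_wtSpace hx hv i) j using 2
    rw [hij']
    module
  · have hij' : (j : k) = i - n := by exact_mod_cast congrArg (Int.cast (R := k)) hij
    refine ⟨n, hn, _, hw, ?_⟩
    convert toEnd_pow_mem_wtSpace hx (toEnd_pow_mem_wtSpace hf hv i) j using 2
    rw [hij']
    module

theorem lie_ne_zero_of_nonisotropic {α β : Dual k 𝔥} (h : B.onDual 𝔥 α α ≠ 0)
    (hβ : 2 * B.onDual 𝔥 α β / B.onDual 𝔥 α α = -1) {x : L₀} (hx0 : x ≠ 0)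
    (hx : x ∈ wtSpace L₀ α) {v : L₀} (hv0 : v ≠ 0) (hv : v ∈ wtSpace L₀ β) : ⁅x, v⁆ ≠ 0 := by
  intro hxv
  obtain ⟨y, hy, hxy⟩ := exists_even_dual B ht hx hx0
  have t := isSl2Triple_of_nonisotropic B hnd h hx hy hxy
  have P : IsSl2Triple.HasPrimitiveVectorWith t v (-1 : k) := by
    refine ⟨hv0, ?_, hxv⟩
    rw [smul_lie, hv, smul_smul, ← onDual_apply B hnd, ← hβ]
    congr 1
    ring
  obtain ⟨n, hn⟩ := P.exists_nat
  have : (n + 1 : ℕ) = 0 := by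
    rw [← Nat.cast_eq_zero (R := k)]
    push_cast
    linear_combination -hn
  omega

theorem isWeight_even_reflection [FiniteDimensional k L₁] {α β : Dual k 𝔥} (h : B.onDual 𝔥 α α ≠ 0)
    {x : L₀} (hx0 : x ≠ 0) (hx : x ∈ wtSpace L₀ α) (hβ : IsWeight L₁ β) :
    ∃ n : ℤ, 2 * B.onDual 𝔥 α β / B.onDual 𝔥 α α = n ∧ IsWeight L₁ (β - (n : k) • α) := by
  obtain ⟨v, hv0, hv⟩ | ⟨v, hv0, hv⟩ := hβ
  · obtain ⟨n, hn, hw⟩ := even_reflection B hnd ht h hx0 hx hv0 hv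
    exact ⟨n, hn, Or.inl hw⟩
  · obtain ⟨n, hn, hw⟩ := even_reflection B hnd ht h hx0 hx hv0 hv
    exact ⟨n, hn, Or.inr hw⟩

theorem root_reflection [FiniteDimensional k L₁] {α β : Dual k 𝔥} (hα : α ∈ roots L₁ 𝔥) (h : B.onDual 𝔥 α α ≠ 0)
    (hβ : β ∈ roots L₁ 𝔥) :
    (∃ n : ℤ, 2 * B.onDual 𝔥 α β / B.onDual 𝔥 α α = n) ∧
      β - (2 * B.onDual 𝔥 α β / B.onDual 𝔥 α α) • α ∈ roots L₁ 𝔥 := by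
  obtain ⟨-, ⟨x, hx0, hx⟩ | ⟨u, hu0, hu⟩⟩ := hα
  · obtain ⟨n, hn, hw⟩ := isWeight_even_reflection B hnd ht h hx0 hx hβ.2
    exact ⟨⟨n, hn⟩, sub_smul_ne_zero h hβ.1, hn ▸ hw⟩
  · obtain ⟨x, hx0, hx⟩ := exists_even_of_odd_nonisotropic B hnd ht h hu0 hu
    have h4 : B.onDual 𝔥 (α + α) (α + α) = 4 * B.onDual 𝔥 α α := by
      simp only [map_add, LinearMap.add_apply]; ring
    have h2 : B.onDual 𝔥 (α + α) β = 2 * B.onDual 𝔥 α β := by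
      simp only [map_add, LinearMap.add_apply]; ring
    obtain ⟨n, hn, hw⟩ := isWeight_even_reflection B hnd ht
      (by rw [h4]; exact mul_ne_zero (by norm_num) h) hx0 hx hβ.2
    have hn' : 2 * B.onDual 𝔥 α β / B.onDual 𝔥 α α = ((2 * n : ℤ) : k) := by
      push_cast
      rw [← hn, h4, h2]
      field_simp
      ring
    refine ⟨⟨_, hn'⟩, sub_smul_ne_zero h hβ.1, ?_⟩
    change IsWeight L₁ _
    rw [hn']
    convert hw using 1
    push_cast
    module

theorem isFormRootSystem_nonisotropic_roots [FiniteDimensional k L₁] :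
    IsFormRootSystem (B.onDual 𝔥) {α | α ∈ roots L₁ 𝔥 ∧ B.onDual 𝔥 α α ≠ 0} :=
  isFormRootSystem_of_reflection_mem ((finite_roots ht).subset fun _ h => h.1) (fun _ h => h.2)
    (fun _ hα _ hβ => (root_reflection B hnd ht hα.1 hα.2 hβ.1).1)
    (fun _ hα β hβ => ⟨(root_reflection B hnd ht hα.1 hα.2 hβ.1).2, by
      rw [onDual_reflection_self B hnd hα.2]; exact hβ.2⟩)

end Cartan

end Super

end LieSuperalgebra

/-! ### The involution and the restriction of roots -/

namespace LieSuperalgebra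

lemma isSemisimple_toEnd_add_smul {k L V : Type*} [Field k] [CharZero k] [LieRing L]
    [LieAlgebra k L] [AddCommGroup V] [Module k V] [LieRingModule L V] [LieModule k L V]
    [FiniteDimensional k V] {t s : L} (hts : ⁅t, s⁆ = 0)
    (ht : (LieModule.toEnd k L V t).IsSemisimple) (hs : (LieModule.toEnd k L V s).IsSemisimple)
    (c : k) : (LieModule.toEnd k L V (t + c • s)).IsSemisimple := by
  rw [map_add, map_smul]
  refine Module.End.IsSemisimple.add_of_commute ?_ ht (Module.End.IsSemisimple_smul c hs)
  refine Commute.smul_right (LinearMap.ext fun v => ?_) c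
  have := lie_lie t s v
  rw [hts, zero_lie] at this
  exact sub_eq_zero.mp this.symm

section Involution

variable {k L₀ L₁ : Type*} [Field k] [LieRing L₀] [LieAlgebra k L₀]
  [AddCommGroup L₁] [Module k L₁] [LieRingModule L₀ L₁] [LieModule k L₀ L₁]
  [LieSuperalgebra k L₀ L₁] {θ : Involution k L₀ L₁} {𝔞 𝔥 : LieSubalgebra k L₀}

/-- The action `χ ↦ χ ∘ θ` of the involution on the dual of a `θ`-stable subalgebra. -/
def Involution.dualAct (θ : Involution k L₀ L₁) (hst : ∀ x ∈ 𝔥, θ.even x ∈ 𝔥) :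
    Dual k 𝔥 →ₗ[k] Dual k 𝔥 :=
  LinearMap.dualMap ((θ.even : L₀ →ₗ[k] L₀).restrict (p := 𝔥.toSubmodule)
    (q := 𝔥.toSubmodule) hst)

variable (hst : ∀ x ∈ 𝔥, θ.even x ∈ 𝔥)

lemma dualAct_apply (χ : Dual k 𝔥) (t : 𝔥) :
    θ.dualAct hst χ t = χ ⟨θ.even t, hst t t.2⟩ := rfl

lemma dualAct_dualAct (χ : Dual k 𝔥) : θ.dualAct hst (θ.dualAct hst χ) = χ := by
  ext t
  rw [dualAct_apply, dualAct_apply]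
  exact congrArg χ (Subtype.ext (θ.even_even t))

lemma even_mem_wtSpace {χ : Dual k 𝔥} {x : L₀} (hx : x ∈ wtSpace L₀ χ) :
    θ.even x ∈ wtSpace L₀ (θ.dualAct hst χ) := fun t => by
  have := congrArg θ.even (hx ⟨θ.even t, hst t t.2⟩)
  rwa [LieEquiv.map_lie, map_smul, θ.even_even] at this

lemma odd_mem_wtSpace {χ : Dual k 𝔥} {u : L₁} (hu : u ∈ wtSpace L₁ χ) :
    θ.odd u ∈ wtSpace L₁ (θ.dualAct hst χ) := fun t => by
  have := congrArg θ.odd (hu ⟨θ.even t, hst t t.2⟩)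
  rwa [θ.odd_lie, map_smul, θ.even_even] at this

lemma dualAct_mem_roots {χ : Dual k 𝔥} (hχ : χ ∈ roots L₁ 𝔥) :
    θ.dualAct hst χ ∈ roots L₁ 𝔥 := by
  refine ⟨fun h0 => hχ.1 ?_, ?_⟩
  · rw [← dualAct_dualAct hst χ, h0, map_zero]
  · obtain ⟨-, ⟨x, hx0, hx⟩ | ⟨x, hx0, hx⟩⟩ := hχ
    · exact Or.inl ⟨θ.even x, by simpa using hx0, even_mem_wtSpace hst hx⟩
    · exact Or.inr ⟨θ.odd x, by simpa using hx0, odd_mem_wtSpace hst hx⟩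

section Form

variable {B : InvariantForm k L₀ L₁} (hB : θ.Preserves B)
include hB

lemma even_apply_left (x y : L₀) : B.even (θ.even x) y = B.even x (θ.even y) := by
  rw [← hB.1, θ.even_even]

variable [FiniteDimensional k L₀] (hnd : (B.restrict 𝔥).Nondegenerate)

lemma dualVec_dualAct (χ : Dual k 𝔥) :
    (dualVec hnd (θ.dualAct hst χ) : L₀) = θ.even (dualVec hnd χ) := by
  have : dualVec hnd (θ.dualAct hst χ) = ⟨θ.even (dualVec hnd χ), hst _ (dualVec hnd χ).2⟩ := by
    refine eq_of_even_eq B hnd fun r => ?_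
    rw [even_dualVec, dualAct_apply, even_apply_left hB]
    exact (even_dualVec B hnd χ ⟨θ.even r, hst r r.2⟩).symm
  exact congrArg Subtype.val this

include hnd in
lemma onDual_dualAct_left (χ ψ : Dual k 𝔥) :
    B.onDual 𝔥 (θ.dualAct hst χ) ψ = B.onDual 𝔥 χ (θ.dualAct hst ψ) := by
  rw [onDual_apply B hnd, onDual_apply B hnd, dualAct_apply]
  exact congrArg ψ (Subtype.ext (dualVec_dualAct hst hB hnd χ))

include hnd in
lemma onDual_dualAct_dualAct (χ ψ : Dual k 𝔥) :
    B.onDual 𝔥 (θ.dualAct hst χ) (θ.dualAct hst ψ) = B.onDual 𝔥 χ ψ := by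
  rw [onDual_dualAct_left hst hB hnd, dualAct_dualAct]

end Form

/-- By maximality, `𝔞` is the whole `(-1)`-eigenspace of `θ` on `𝔥`. -/
lemma mem_cartanSubspace_iff (h𝔞 : θ.IsCartanSubspace 𝔞) (h𝔥 : θ.IsCartanOver 𝔞 𝔥) {x : L₀} :
    x ∈ 𝔞 ↔ x ∈ 𝔥 ∧ θ.even x = -x := by
  refine ⟨fun hx => ⟨h𝔥.le hx, h𝔞.neg x hx⟩, fun hx => ?_⟩
  let 𝔟 : LieSubalgebra k L₀ :=
    { carrier := {x | x ∈ 𝔥 ∧ θ.even x = -x}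
      add_mem' := fun {x y} hx hy =>
        ⟨add_mem hx.1 hy.1, by rw [map_add, hx.2, hy.2, neg_add]⟩
      zero_mem' := ⟨zero_mem _, by simp⟩
      smul_mem' := fun c x hx => ⟨𝔥.smul_mem c hx.1, by rw [map_smul, hx.2, smul_neg]⟩
      lie_mem' := fun {x y} hx hy => by
        change ⁅x, y⁆ ∈ 𝔥 ∧ _
        rw [h𝔥.toral.lie_eq_zero x hx.1 y hy.1]
        exact ⟨zero_mem _, by simp⟩ }
  have h𝔟 : IsToral L₁ 𝔟 :=
    ⟨fun x hx y hy => h𝔥.toral.lie_eq_zero x hx.1 y hy.1,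
      fun x hx => h𝔥.toral.semisimple_even x hx.1, fun x hx => h𝔥.toral.semisimple_odd x hx.1⟩
  rw [← h𝔞.maximal 𝔟 h𝔟 (fun x hx => hx.2) fun x hx => ⟨h𝔥.le hx, h𝔞.neg x hx⟩]
  exact hx

lemma res_apply (hle : 𝔞 ≤ 𝔥) (χ : Dual k 𝔥) (t : 𝔞) : res hle χ t = χ ⟨t, hle t.2⟩ := rfl

lemma res_dualAct (h𝔞 : θ.IsCartanSubspace 𝔞) (hle : 𝔞 ≤ 𝔥) (χ : Dual k 𝔥) :
    res hle (θ.dualAct hst χ) = -res hle χ := by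
  ext t
  rw [LinearMap.neg_apply, res_apply, res_apply, dualAct_apply, ← map_neg]
  exact congrArg χ (Subtype.ext (h𝔞.neg t t.2))

variable {B : InvariantForm k L₀ L₁} [CharZero k]

section

variable (hB : θ.Preserves B)
include hB

lemma restrict_cartanSubspace_nondegenerate (h𝔞 : θ.IsCartanSubspace 𝔞)
    (h𝔥 : θ.IsCartanOver 𝔞 𝔥) (hnd : (B.restrict 𝔥).Nondegenerate) :
    (B.restrict 𝔞).Nondegenerate := by
  have key : ∀ t : 𝔞, (∀ s : 𝔞, B.even t s = 0) → t = 0 := by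
    intro t h
    have h0 : (⟨t, h𝔥.le t.2⟩ : 𝔥) = 0 := by
      refine hnd.1 _ fun s => ?_
      -- `t` is orthogonal to `s + θ s`, and `s - θ s` lies in `𝔞`
      have hmem : (s : L₀) - θ.even s ∈ 𝔞 := (mem_cartanSubspace_iff h𝔞 h𝔥).mpr
        ⟨sub_mem s.2 (h𝔥.stable s s.2), by rw [map_sub, θ.even_even, neg_sub]⟩
      have h1 := h ⟨_, hmem⟩
      change B.even t (s - θ.even s) = 0 at h1
      rw [map_sub, ← even_apply_left hB, h𝔞.neg t t.2, map_neg, LinearMap.neg_apply,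
        sub_neg_eq_add, ← two_mul, mul_eq_zero] at h1
      exact h1.resolve_left two_ne_zero
    exact Subtype.ext (congrArg (fun r : 𝔥 => (r : L₀)) h0)
  refine ⟨fun t h => key t h, fun t h => key t fun s => ?_⟩
  rw [B.even_symm]
  exact h s

/-- Restriction to `𝔞` is, up to the identification of `𝔞*` with a subspace of `𝔥*`, the orthogonal
projection `χ ↦ (χ - χ ∘ θ) / 2`. -/
lemma onDual_res_res [FiniteDimensional k L₀] (h𝔞 : θ.IsCartanSubspace 𝔞)
    (h𝔥 : θ.IsCartanOver 𝔞 𝔥) (hnd : (B.restrict 𝔥).Nondegenerate)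
    (χ ψ : Dual k 𝔥) :
    2 * B.onDual 𝔞 (res h𝔥.le χ) (res h𝔥.le ψ) =
      B.onDual 𝔥 χ ψ - B.onDual 𝔥 (θ.dualAct h𝔥.stable χ) ψ := by
  have hnd' := restrict_cartanSubspace_nondegenerate hB h𝔞 h𝔥 hnd
  have hmem : (dualVec hnd χ : L₀) - θ.even (dualVec hnd χ) ∈ 𝔞 :=
    (mem_cartanSubspace_iff h𝔞 h𝔥).mpr ⟨sub_mem (dualVec hnd χ).2
      (h𝔥.stable _ (dualVec hnd χ).2), by rw [map_sub, θ.even_even, neg_sub]⟩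
  have h2 : (2 : k) • dualVec hnd' (res h𝔥.le χ) = ⟨_, hmem⟩ := by
    refine eq_of_even_eq B hnd' fun r => ?_
    change B.even ((2 : k) • (dualVec hnd' (res h𝔥.le χ) : L₀)) r
      = B.even ((dualVec hnd χ : L₀) - θ.even (dualVec hnd χ)) r
    have h3 : B.even (dualVec hnd χ) r = χ ⟨r, h𝔥.le r.2⟩ := even_dualVec B hnd χ ⟨r, h𝔥.le r.2⟩
    rw [map_smul, LinearMap.smul_apply, even_dualVec, map_sub, LinearMap.sub_apply,
      even_apply_left hB, h𝔞.neg r r.2, map_neg, h3, res_apply, smul_eq_mul]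
    ring
  rw [onDual_apply B hnd', onDual_apply B hnd, onDual_apply B hnd, ← map_sub, ← smul_eq_mul,
    ← map_smul, h2]
  refine congrArg ψ (Subtype.ext ?_)
  change _ = (dualVec hnd χ : L₀) - (dualVec hnd (θ.dualAct h𝔥.stable χ) : L₀)
  rw [dualVec_dualAct h𝔥.stable hB]
  rfl

end

/-- An element of `𝔭₀` that commutes with `𝔞` and acts semisimply lies in `𝔞`. -/
lemma mem_cartanSubspace_of_isSemisimple [FiniteDimensional k L₀] [FiniteDimensional k L₁]
    (h𝔞 : θ.IsCartanSubspace 𝔞) {s : L₀} (hθ : θ.even s = -s)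
    (hcomm : ∀ t ∈ 𝔞, ⁅t, s⁆ = 0) (h₀ : (LieModule.toEnd k L₀ L₀ s).IsSemisimple)
    (h₁ : (LieModule.toEnd k L₀ L₁ s).IsSemisimple) : s ∈ 𝔞 := by
  have hcomm' : ∀ t ∈ 𝔞, ⁅s, t⁆ = 0 := fun t ht => by rw [← lie_skew, hcomm t ht, neg_zero]
  have hrep : ∀ x ∈ 𝔞.toSubmodule ⊔ span k {s}, ∃ t ∈ 𝔞, ∃ c : k, x = t + c • s := by
    intro x hx
    obtain ⟨t, ht, y, hy, rfl⟩ := Submodule.mem_sup.mp hx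
    obtain ⟨c, rfl⟩ := Submodule.mem_span_singleton.mp hy
    exact ⟨t, ht, c, rfl⟩
  have hab : ∀ x ∈ 𝔞.toSubmodule ⊔ span k {s}, ∀ y ∈ 𝔞.toSubmodule ⊔ span k {s},
      ⁅x, y⁆ = 0 := by
    intro x hx y hy
    obtain ⟨t, ht, c, rfl⟩ := hrep x hx
    obtain ⟨t', ht', c', rfl⟩ := hrep y hy
    simp [hcomm t ht, hcomm' t' ht', h𝔞.toral.lie_eq_zero t ht t' ht']
  let 𝔟 : LieSubalgebra k L₀ :=
    { 𝔞.toSubmodule ⊔ span k {s} with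
      lie_mem' := fun {x y} hx hy => by
        change ⁅x, y⁆ ∈ 𝔞.toSubmodule ⊔ span k {s}
        rw [hab x hx y hy]
        exact zero_mem _ }
  have h𝔟 : IsToral L₁ 𝔟 := by
    refine ⟨hab, fun x hx => ?_, fun x hx => ?_⟩
    · obtain ⟨t, ht, c, rfl⟩ := hrep x hx
      exact isSemisimple_toEnd_add_smul (hcomm t ht) (h𝔞.toral.semisimple_even t ht) h₀ c
    · obtain ⟨t, ht, c, rfl⟩ := hrep x hx
      exact isSemisimple_toEnd_add_smul (hcomm t ht) (h𝔞.toral.semisimple_odd t ht) h₁ c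
  rw [← h𝔞.maximal 𝔟 h𝔟 ?_ fun x hx => Submodule.mem_sup_left hx]
  · exact Submodule.mem_sup_right (Submodule.mem_span_singleton_self s)
  · intro x hx
    obtain ⟨t, ht, c, rfl⟩ := hrep x hx
    rw [map_add, map_smul, h𝔞.neg t ht, hθ]
    module

section Cartan

variable [IsAlgClosed k] [FiniteDimensional k L₀] [FiniteDimensional k L₁]
  (hB : θ.Preserves B) (h𝔞 : θ.IsCartanSubspace 𝔞) (h𝔥 : θ.IsCartanOver 𝔞 𝔥)
  (hnd : (B.restrict 𝔥).Nondegenerate)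

include hB h𝔞 hnd

/-- The involution has no eigenvalue `-1` on the root space of a nonisotropic even root `β` with
`β ∘ θ = β`. Otherwise there is an `sl₂`-triple for `β` with `e`, `f ∈ 𝔭₀`; since `β` vanishes on
`𝔞`, maximality of `𝔞` puts the semisimple element `e + f` into `𝔞 ⊆ 𝔥`, which is absurd. -/
theorem eq_zero_of_dualAct_eq_self {β : Dual k 𝔥} (h : B.onDual 𝔥 β β ≠ 0)
    (hβ : θ.dualAct h𝔥.stable β = β) {x : L₀} (hx : x ∈ wtSpace L₀ β)
    (hθ : θ.even x = -x) : x = 0 := by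
  by_contra hx0
  have := h𝔥.cartan
  obtain ⟨y', hy', hxy'⟩ := exists_even_dual B h𝔥.toral hx hx0
  set y := y' - θ.even y' with hydef
  have hy : y ∈ wtSpace L₀ (-β) := by
    refine sub_mem hy' ?_
    have := even_mem_wtSpace (θ := θ) h𝔥.stable hy'
    rwa [map_neg, hβ] at this
  have hθy : θ.even y = -y := by rw [hydef, map_sub, θ.even_even, neg_sub]
  have hxy : B.even x y ≠ 0 := by
    rw [hydef, map_sub, ← even_apply_left hB, hθ, map_neg, LinearMap.neg_apply, sub_neg_eq_add,
      ← two_mul]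
    exact mul_ne_zero two_ne_zero hxy'
  have t := isSl2Triple_of_nonisotropic B hnd h hx hy hxy
  have hf := (wtSpace L₀ (-β)).smul_mem (2 / (B.onDual 𝔥 β β * B.even x y)) hy
  have hθf : θ.even ((2 / (B.onDual 𝔥 β β * B.even x y)) • y)
      = -((2 / (B.onDual 𝔥 β β * B.even x y)) • y) := by rw [map_smul, hθy, smul_neg]
  have hh : (2 / B.onDual 𝔥 β β) • (dualVec hnd β : L₀) ∈ 𝔥 := 𝔥.smul_mem _ (dualVec hnd β).2
  set f := (2 / (B.onDual 𝔥 β β * B.even x y)) • y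
  set r := (2 / B.onDual 𝔥 β β) • (dualVec hnd β : L₀)
  have hβ0 : ∀ s, ∀ hs : s ∈ 𝔞, β ⟨s, h𝔥.le hs⟩ = 0 := by
    intro s hs
    have h1 : β ⟨s, h𝔥.le hs⟩ = -β ⟨s, h𝔥.le hs⟩ := by
      conv_lhs => rw [← hβ, dualAct_apply]
      rw [← map_neg]
      exact congrArg β (Subtype.ext (h𝔞.neg s hs))
    exact self_eq_neg.mp h1
  have hmem : x + f ∈ 𝔞 := by
    refine mem_cartanSubspace_of_isSemisimple h𝔞 (by rw [map_add, hθ, hθf, neg_add]) ?_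
      (t.isSemisimple_toEnd_add (h𝔥.toral.semisimple_even _ hh))
      (t.isSemisimple_toEnd_add (h𝔥.toral.semisimple_odd _ hh))
    intro s hs
    have h1 := hx ⟨s, h𝔥.le hs⟩
    have h2 := hf ⟨s, h𝔥.le hs⟩
    rw [LinearMap.neg_apply] at h2
    rw [hβ0 s hs] at h1 h2
    rw [lie_add, h1, h2]
    simp
  -- `h` commutes with `e + f`, so `e = f`, and then `2 e = [h, e] = [h, f] = -2 f`
  have h0 := h𝔥.toral.lie_eq_zero _ hh _ (h𝔥.le hmem)
  rw [lie_add, t.lie_h_e_smul k, t.lie_lie_smul_f k, ← sub_eq_add_neg, ← smul_sub,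
    smul_eq_zero_iff_right two_ne_zero, sub_eq_zero] at h0
  have h1 := t.lie_h_e_smul k
  have h2 := t.lie_lie_smul_f k
  rw [← h0, h1, ← smul_neg] at h2
  have h3 := smul_right_injective L₀ (two_ne_zero (α := k)) h2
  have : IsAddTorsionFree L₀ := .of_isTorsionFree k L₀
  exact hx0 (self_eq_neg.mp h3)

/-- Let `α` be a nonisotropic even root whose restriction `a` to `𝔞` is nonzero. The reflection
in `a` lifts to an isometry of `𝔥*` that preserves the roots: with `α' = -(α ∘ θ)`, a root of the
same length and the same restriction, it lifts to the reflection in `α` if `α' = α`, to the product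
of the reflections in `α` and `α'` if these are orthogonal, and to the reflection in the root
`α + α'` if the Cartan number of `α` and `α'` is `-1`. -/
theorem restricted_reflection_of_even {α : Dual k 𝔥} (h : B.onDual 𝔥 α α ≠ 0)
    {x : L₀} (hx0 : x ≠ 0) (hx : x ∈ wtSpace L₀ α) (hres : res h𝔥.le α ≠ 0) :
    B.onDual 𝔞 (res h𝔥.le α) (res h𝔥.le α) ≠ 0 ∧ ∀ β ∈ roots L₁ 𝔥,
      (∃ n : ℤ, 2 * B.onDual 𝔞 (res h𝔥.le α) (res h𝔥.le β) /
        B.onDual 𝔞 (res h𝔥.le α) (res h𝔥.le α) = n) ∧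
      ∃ γ ∈ roots L₁ 𝔥, B.onDual 𝔥 γ γ = B.onDual 𝔥 β β ∧
        res h𝔥.le γ = res h𝔥.le β - (2 * B.onDual 𝔞 (res h𝔥.le α) (res h𝔥.le β) /
          B.onDual 𝔞 (res h𝔥.le α) (res h𝔥.le α)) • res h𝔥.le α := by
  have := h𝔥.cartan
  have ht := h𝔥.toral
  have hα : α ∈ roots L₁ 𝔥 := ⟨fun h0 => by simp [h0] at h, Or.inl ⟨x, hx0, hx⟩⟩
  set α' : Dual k 𝔥 := -θ.dualAct h𝔥.stable α with hα'def
  have hα' : α' ∈ roots L₁ 𝔥 := neg_mem_roots B ht (dualAct_mem_roots h𝔥.stable hα)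
  have hlen : B.onDual 𝔥 α' α' = B.onDual 𝔥 α α := by
    rw [hα'def, map_neg, map_neg, LinearMap.neg_apply, neg_neg,
      onDual_dualAct_dualAct h𝔥.stable hB hnd]
  have h' : B.onDual 𝔥 α' α' ≠ 0 := hlen ▸ h
  have hres' : res h𝔥.le α' = res h𝔥.le α := by
    rw [hα'def, map_neg, res_dualAct h𝔥.stable h𝔞, neg_neg]
  have hQ : ∀ β, 2 * B.onDual 𝔞 (res h𝔥.le α) (res h𝔥.le β) =
      B.onDual 𝔥 α β + B.onDual 𝔥 α' β := fun β => by
    rw [onDual_res_res hB h𝔞 h𝔥 hnd, hα'def, map_neg, LinearMap.neg_apply, sub_eq_add_neg]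
  have hsymm := onDual_symm B hnd α α'
  set A := B.onDual 𝔥
  set Q := B.onDual 𝔞
  set a := res h𝔥.le α
  have hQaa : Q a a = (A α α + A α' α) / 2 := by
    rw [← hQ, mul_div_cancel_left₀ _ two_ne_zero]
  rcases (isFormRootSystem_nonisotropic_roots B hnd ht).cartan_number_of_length_eq
    ⟨hα, h⟩ ⟨hα', h'⟩ hlen.symm hsymm with hc | hc | hc | hc | hc
  · -- `α' = α`
    have hQaa' : Q a a = A α α := by rw [hQaa, ← hc]; ring
    refine ⟨hQaa' ▸ h, fun β hβ => ?_⟩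
    obtain ⟨⟨n, hn⟩, hr⟩ := root_reflection B hnd ht hα h hβ
    have hk : 2 * Q a (res h𝔥.le β) / Q a a = 2 * A α β / A α α := by
      rw [hQ, hQaa', ← hc, two_mul]
    rw [hk]
    exact ⟨⟨n, hn⟩, _, hr, onDual_reflection_self B hnd h β, by rw [map_sub, map_smul]⟩
  · -- `α' = -α` is impossible, since `α` and `α'` have the same nonzero restriction
    exfalso
    have h1 : a = -a := by
      conv_lhs => rw [← hres']
      rw [← map_neg, ← neg_eq_iff_eq_neg.mpr hc]
    have : IsAddTorsionFree (Dual k 𝔞) := .of_isTorsionFree k _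
    exact hres (self_eq_neg.mp h1)
  · -- Cartan number `1`: then `[x, θ x]` is nonzero, anti-invariant and of weight `α - α'`
    exfalso
    have hτ : A α (θ.dualAct h𝔥.stable α) = -A α α' := by rw [hα'def, map_neg, neg_neg]
    have hne := lie_ne_zero_of_nonisotropic B hnd ht h
      (β := θ.dualAct h𝔥.stable α) (by
        change 2 * A α (θ.dualAct h𝔥.stable α) / A α α = -1
        rw [hτ, mul_neg, neg_div, hc]) hx0 hx (v := θ.even x) (by simpa using hx0)
      (even_mem_wtSpace h𝔥.stable hx)
    refine hne (eq_zero_of_dualAct_eq_self hB h𝔞 h𝔥 hnd (β := α + θ.dualAct h𝔥.stable α) ?_ ?_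
      (lie_mem_wtSpace hx (even_mem_wtSpace h𝔥.stable hx)) ?_)
    · have h1 : A α α' = A α α / 2 := by
        rw [div_eq_one_iff_eq h] at hc
        linear_combination hc / 2
      have h2 : A (α + θ.dualAct h𝔥.stable α) (α + θ.dualAct h𝔥.stable α) = A α α := by
        have h3 : θ.dualAct h𝔥.stable α = -α' := by rw [hα'def, neg_neg]
        rw [h3]
        simp only [map_add, map_neg, LinearMap.add_apply, LinearMap.neg_apply]
        rw [hlen, ← hsymm, h1]
        ring
      exact h2 ▸ h
    · rw [map_add, dualAct_dualAct, add_comm]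
    · rw [LieEquiv.map_lie, θ.even_even, lie_skew]
  · -- `α` and `α'` are orthogonal
    have h0 : A α α' = 0 := by
      rw [div_eq_zero_iff, mul_eq_zero] at hc
      exact (hc.resolve_right h).resolve_left two_ne_zero
    have hQaa' : Q a a = A α α / 2 := by rw [hQaa, ← hsymm, h0, add_zero]
    refine ⟨hQaa' ▸ div_ne_zero h two_ne_zero, fun β hβ => ?_⟩
    obtain ⟨⟨n, hn⟩, hr⟩ := root_reflection B hnd ht hα h hβ
    obtain ⟨⟨n', hn'⟩, hr'⟩ := root_reflection B hnd ht hα' h' hr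
    have hk' : A α' (β - (2 * A α β / A α α) • α) = A α' β := by
      rw [map_sub, map_smul, ← hsymm, h0, smul_zero, sub_zero]
    have hk : 2 * Q a (res h𝔥.le β) / Q a a = 2 * A α β / A α α + 2 * A α' β / A α' α' := by
      rw [hQ, hQaa', hlen]
      field_simp
    refine ⟨⟨n + n', ?_⟩, _, hr', ?_, ?_⟩
    · rw [hk, hn, Int.cast_add, ← hn']
      change _ = _ + 2 * A α' (β - (2 * A α β / A α α) • α) / A α' α'
      rw [hk']
    · exact (onDual_reflection_self B hnd h' _).trans (onDual_reflection_self B hnd h _)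
    · change res h𝔥.le (β - (2 * A α β / A α α) • α
        - (2 * A α' (β - (2 * A α β / A α α) • α) / A α' α') • α') = _
      rw [hk', map_sub, map_sub, map_smul, map_smul, hres', hk, add_smul, sub_sub]
  · -- Cartan number `-1`: the root `α + α'` restricts to `2 a`
    have h1 : A α α' = -A α α / 2 := by
      rw [div_eq_iff h] at hc
      linear_combination hc / 2
    have hγ : α + α' ∈ roots L₁ 𝔥 := by
      have := (root_reflection B hnd ht hα h hα').2
      change α' - (2 * A α α' / A α α) • α ∈ _ at this
      rwa [hc, neg_one_smul k α, sub_neg_eq_add, add_comm] at this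
    have hγlen : A (α + α') (α + α') = A α α := by
      simp only [map_add, LinearMap.add_apply]
      rw [hlen, ← hsymm, h1]
      ring
    have hγ0 : A (α + α') (α + α') ≠ 0 := hγlen ▸ h
    have hQaa' : Q a a = A α α / 4 := by rw [hQaa, ← hsymm, h1]; ring
    refine ⟨hQaa' ▸ div_ne_zero h (by norm_num), fun β hβ => ?_⟩
    obtain ⟨⟨n, hn⟩, hr⟩ := root_reflection B hnd ht hγ hγ0 hβ
    have hk : 2 * Q a (res h𝔥.le β) / Q a a
        = 2 * (2 * A (α + α') β / A (α + α') (α + α')) := by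
      rw [hQ, hQaa', hγlen, map_add, LinearMap.add_apply]
      field_simp
      ring
    refine ⟨⟨2 * n, ?_⟩, _, hr, onDual_reflection_self B hnd hγ0 β, ?_⟩
    · rw [hk, Int.cast_mul, ← hn]
      simp [A]
    · rw [map_sub, map_smul, map_add (res h𝔥.le), hres', hk]
      module

/-- The reflection in the restriction of any nonisotropic root: for an odd root, pass to its
double, which is even. -/
theorem restricted_reflection {α : Dual k 𝔥} (hα : α ∈ roots L₁ 𝔥)
    (h : B.onDual 𝔥 α α ≠ 0) (hres : res h𝔥.le α ≠ 0) :
    B.onDual 𝔞 (res h𝔥.le α) (res h𝔥.le α) ≠ 0 ∧ ∀ β ∈ roots L₁ 𝔥,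
      (∃ n : ℤ, 2 * B.onDual 𝔞 (res h𝔥.le α) (res h𝔥.le β) /
        B.onDual 𝔞 (res h𝔥.le α) (res h𝔥.le α) = n) ∧
      ∃ γ ∈ roots L₁ 𝔥, B.onDual 𝔥 γ γ = B.onDual 𝔥 β β ∧
        res h𝔥.le γ = res h𝔥.le β - (2 * B.onDual 𝔞 (res h𝔥.le α) (res h𝔥.le β) /
          B.onDual 𝔞 (res h𝔥.le α) (res h𝔥.le α)) • res h𝔥.le α := by
  have := h𝔥.cartan
  obtain ⟨-, ⟨x, hx0, hx⟩ | ⟨u, hu0, hu⟩⟩ := hα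
  · exact restricted_reflection_of_even hB h𝔞 h𝔥 hnd h hx0 hx hres
  obtain ⟨x, hx0, hx⟩ := exists_even_of_odd_nonisotropic B hnd h𝔥.toral h hu0 hu
  have h2 : α + α = (2 : k) • α := (two_smul k α).symm
  rw [h2] at hx
  obtain ⟨hne, hr⟩ := restricted_reflection_of_even hB h𝔞 h𝔥 hnd (α := (2 : k) • α)
    (by simpa using h) hx0 hx (by simpa using hres)
  set Q := B.onDual 𝔞
  set a := res h𝔥.le α
  have hQ4 : Q (res h𝔥.le ((2 : k) • α)) (res h𝔥.le ((2 : k) • α)) = 4 * Q a a := by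
    simp only [map_smul, LinearMap.smul_apply, smul_eq_mul]
    ring
  have hQ2 : ∀ b, Q (res h𝔥.le ((2 : k) • α)) b = 2 * Q a b := fun b => by
    simp only [map_smul, LinearMap.smul_apply, smul_eq_mul]
    rfl
  have hQa : Q a a ≠ 0 := fun h0 => hne (by rw [hQ4, h0, mul_zero])
  refine ⟨hQa, fun β hβ => ?_⟩
  obtain ⟨⟨n, hn⟩, γ, hγ, hlen, hγres⟩ := hr β hβ
  have hk : 2 * Q a (res h𝔥.le β) / Q a a = ((2 * n : ℤ) : k) := by
    push_cast
    rw [← hn, hQ4, hQ2]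
    field_simp
    ring
  refine ⟨⟨_, hk⟩, γ, hγ, hlen, ?_⟩
  rw [hγres, hn, hk, map_smul]
  push_cast
  module

end Cartan

end Involution

end LieSuperalgebra

/-! ### Restricted roots -/

namespace LieSuperalgebra

section Span

variable {k L₀ L₁ : Type*} [Field k] [IsAlgClosed k] [LieRing L₀] [LieAlgebra k L₀]
  [AddCommGroup L₁] [Module k L₁] [LieRingModule L₀ L₁] [LieModule k L₀ L₁]
  {𝔥 : LieSubalgebra k L₀}

/-- Since the superalgebra is the sum of its weight spaces, the center is the common kernel of the
roots. -/
lemma mem_evenCenter_iff_forall_roots [FiniteDimensional k L₀] [FiniteDimensional k L₁]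
    (ht : IsToral L₁ 𝔥) (t : 𝔥) :
    (t : L₀) ∈ evenCenter k L₀ L₁ ↔ ∀ α ∈ roots L₁ 𝔥, α t = 0 := by
  constructor
  · rintro ⟨h₀, h₁⟩ α ⟨-, ⟨x, hx0, hx⟩ | ⟨x, hx0, hx⟩⟩
    · have := hx t
      rw [h₀ x] at this
      exact (smul_eq_zero.mp this.symm).resolve_right hx0
    · have := hx t
      rw [h₁ x] at this
      exact (smul_eq_zero.mp this.symm).resolve_right hx0
  · intro h
    have hα : ∀ α : Dual k 𝔥, IsWeight L₁ α → α t = 0 := fun α hα => by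
      by_cases h0 : α = 0
      · rw [h0, LinearMap.zero_apply]
      · exact h α ⟨h0, hα⟩
    constructor
    · have hle : ⨆ χ : Dual k 𝔥, wtSpace L₀ χ ≤ LinearMap.ker (LieModule.toEnd k L₀ L₀ t) := by
        refine iSup_le fun χ x hx => ?_
        rw [LinearMap.mem_ker, LieModule.toEnd_apply_apply, hx t]
        rcases eq_or_ne x 0 with rfl | hx0
        · simp
        · rw [hα χ (Or.inl ⟨x, hx0, hx⟩), zero_smul]
      rw [iSup_wtSpace_eq_top ht.lie_eq_zero ht.semisimple_even] at hle
      exact fun y => hle (Submodule.mem_top (x := y))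
    · have hle : ⨆ χ : Dual k 𝔥, wtSpace L₁ χ ≤ LinearMap.ker (LieModule.toEnd k L₀ L₁ t) := by
        refine iSup_le fun χ x hx => ?_
        rw [LinearMap.mem_ker, LieModule.toEnd_apply_apply, hx t]
        rcases eq_or_ne x 0 with rfl | hx0
        · simp
        · rw [hα χ (Or.inr ⟨x, hx0, hx⟩), zero_smul]
      rw [iSup_wtSpace_eq_top ht.lie_eq_zero ht.semisimple_odd] at hle
      exact fun y => hle (Submodule.mem_top (x := y))

theorem span_restrictedRoots [FiniteDimensional k L₀] [FiniteDimensional k L₁]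
    {𝔞 : LieSubalgebra k L₀} (hle : 𝔞 ≤ 𝔥) (ht : IsToral L₁ 𝔥) :
    span k (restrictedRoots L₁ hle) = (Submodule.comap (𝔞.incl : 𝔞 →ₗ[k] L₀)
      (evenCenter k L₀ L₁)).dualAnnihilator := by
  rw [← Subspace.dualCoannihilator_dualAnnihilator_eq (W := span k (restrictedRoots L₁ hle))]
  congr 1
  ext t
  rw [Submodule.mem_dualCoannihilator, Submodule.mem_comap]
  change _ ↔ (((⟨t, hle t.2⟩ : 𝔥) : L₀)) ∈ evenCenter k L₀ L₁
  rw [mem_evenCenter_iff_forall_roots ht]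
  constructor
  · intro h α hα
    by_cases h0 : res hle α = 0
    · exact LinearMap.congr_fun h0 t
    · exact h _ (subset_span ⟨h0, α, hα, rfl⟩)
  · intro h
    have : span k (restrictedRoots L₁ hle) ≤ LinearMap.ker (Dual.eval k 𝔞 t) := by
      rw [span_le]
      rintro _ ⟨-, α, hα, rfl⟩
      exact h α hα
    exact fun φ hφ => this hφ

end Span

end LieSuperalgebra

theorem mainTheorem9 {k L₀ L₁ : Type*} [Field k] [IsAlgClosed k] [CharZero k]
    [LieRing L₀] [LieAlgebra k L₀] [AddCommGroup L₁] [Module k L₁] [LieRingModule L₀ L₁]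
    [LieModule k L₀ L₁] [LieSuperalgebra k L₀ L₁]
    [FiniteDimensional k L₀] [FiniteDimensional k L₁]
    (hred : LieSuperalgebra.IsReductive k L₀)
    (B : LieSuperalgebra.InvariantForm k L₀ L₁)
    (θ : LieSuperalgebra.Involution k L₀ L₁) (hB : θ.Preserves B)
    (𝔞 𝔥 : LieSubalgebra k L₀) (h𝔞 : θ.IsCartanSubspace 𝔞) (h𝔥 : θ.IsCartanOver 𝔞 𝔥) :
    let Q : LinearMap.BilinForm k (Module.Dual k 𝔞) := B.onDual 𝔞
    let Φ : Set (Module.Dual k 𝔞) := LieSuperalgebra.restrictedRoots L₁ h𝔥.le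
    let Φre : Set (Module.Dual k 𝔞) := LieSuperalgebra.realRestrictedRoots B h𝔥.le
    let Φim : Set (Module.Dual k 𝔞) := LieSuperalgebra.imaginaryRestrictedRoots B h𝔥.le
    -- the span: all functions vanishing on the part of `𝔞` that is central in `𝔤`
    (Submodule.span k Φ =
        (Submodule.comap (𝔞.incl : 𝔞 →ₗ[k] L₀)
          (LieSuperalgebra.evenCenter k L₀ L₁)).dualAnnihilator) ∧
    ((∀ x ∈ LieSuperalgebra.evenCenter k L₀ L₁, θ.even x = x) → Submodule.span k Φ = ⊤) ∧
    -- nondegeneracy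
    ((B.restrict 𝔥).Nondegenerate ∧ (B.restrict 𝔞).Nondegenerate ∧ Q.Nondegenerate) ∧
    -- reflections in real restricted roots
    (∀ a ∈ Φre, Q a a ≠ 0 ∧ ∀ b ∈ Φ,
      (∃ n : ℤ, 2 * Q a b / Q a a = n) ∧ b - (2 * Q a b / Q a a) • a ∈ Φ) ∧
    -- imaginary restricted roots
    (∀ a ∈ Φim, ∀ b ∈ Φ, b ≠ a → b ≠ -a → Q a b ≠ 0 → b + a ∈ Φ ∨ b - a ∈ Φ) ∧
    -- symmetry
    (∀ a, a ∈ Φ ↔ -a ∈ Φ) ∧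
    -- the real restricted roots form a root system, whose Weyl group preserves the imaginary ones
    IsFormRootSystem Q Φre ∧
    (∀ w ∈ formWeylGroup Q Φre, (fun a => w a) '' Φim = Φim) := by
  intro Q Φ Φre Φim
  have hcartan := h𝔥.cartan
  have ht := h𝔥.toral
  have hnd : (B.restrict 𝔥).Nondegenerate :=
    LieSuperalgebra.restrict_nondegenerate_of_isCartanSubalgebra B ht
  have hnd' := LieSuperalgebra.restrict_cartanSubspace_nondegenerate hB h𝔞 h𝔥 hnd
  have hspan := LieSuperalgebra.span_restrictedRoots (L₁ := L₁) h𝔥.le ht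
  have hre : ∀ a ∈ Φre, Q a a ≠ 0 ∧ ∀ b ∈ Φ,
      (∃ n : ℤ, 2 * Q a b / Q a a = n) ∧ b - (2 * Q a b / Q a a) • a ∈ Φ := by
    rintro _ ⟨ha0, α, hα, hαα, rfl⟩
    obtain ⟨h0, h⟩ := LieSuperalgebra.restricted_reflection hB h𝔞 h𝔥 hnd hα hαα ha0
    refine ⟨h0, ?_⟩
    rintro _ ⟨hb0, β, hβ, rfl⟩
    obtain ⟨hn, γ, hγ, -, hγres⟩ := h β hβ
    exact ⟨hn, sub_smul_ne_zero h0 hb0, γ, hγ, hγres⟩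
  have hrere : ∀ a ∈ Φre, ∀ b ∈ Φre, b - (2 * Q a b / Q a a) • a ∈ Φre := by
    rintro _ ⟨ha0, α, hα, hαα, rfl⟩ _ ⟨hb0, β, hβ, hββ, rfl⟩
    obtain ⟨h0, h⟩ := LieSuperalgebra.restricted_reflection hB h𝔞 h𝔥 hnd hα hαα ha0
    obtain ⟨-, γ, hγ, hlen, hγres⟩ := h β hβ
    exact ⟨sub_smul_ne_zero h0 hb0, γ, hγ, hlen ▸ hββ, hγres⟩
  have hsub : Φre ⊆ Φ := fun a ⟨ha0, α, hα, _, h⟩ => ⟨ha0, α, hα, h⟩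
  have hneg : ∀ a ∈ Φ, -a ∈ Φ := by
    rintro _ ⟨ha0, α, hα, rfl⟩
    exact ⟨neg_ne_zero.mpr ha0, -α, LieSuperalgebra.neg_mem_roots B ht hα, map_neg _ _⟩
  have hfin : Φ.Finite :=
    ((LieSuperalgebra.finite_roots ht).image (LieSuperalgebra.res h𝔥.le)).subset
      fun a ⟨_, α, hα, h⟩ => ⟨α, hα, h⟩
  refine ⟨hspan, fun hfix => ?_, ⟨hnd, hnd', LieSuperalgebra.onDual_nondegenerate B hnd'⟩, hre,
    ?_, fun a => ⟨hneg a, fun h => neg_neg a ▸ hneg _ h⟩, ?_, ?_⟩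
  · have hbot : Submodule.comap (𝔞.incl : 𝔞 →ₗ[k] L₀)
        (LieSuperalgebra.evenCenter k L₀ L₁) = ⊥ := by
      rw [eq_bot_iff]
      intro t htc
      have h1 : (t : L₀) = -t := (hfix t htc).symm.trans (h𝔞.neg t t.2)
      have : IsAddTorsionFree L₀ := .of_isTorsionFree k L₀
      exact Subtype.ext (self_eq_neg.mp h1)
    exact hspan.trans (by rw [hbot, Submodule.dualAnnihilator_bot])
  · -- replacing `α` by `-(α ∘ θ)` if necessary, `(α, β) ≠ 0`
    rintro _ ⟨⟨ha0, α, hα, rfl⟩, -⟩ _ ⟨hb0, β, hβ, rfl⟩ hne hne' hQ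
    have key : ∀ α' ∈ LieSuperalgebra.roots L₁ 𝔥,
        LieSuperalgebra.res h𝔥.le α' = LieSuperalgebra.res h𝔥.le α → B.onDual 𝔥 α' β ≠ 0 →
        LieSuperalgebra.res h𝔥.le β + LieSuperalgebra.res h𝔥.le α ∈ Φ ∨
          LieSuperalgebra.res h𝔥.le β - LieSuperalgebra.res h𝔥.le α ∈ Φ := by
      intro α' hα' hres h
      rw [← hres, ← map_add, ← map_sub]
      have h1 : LieSuperalgebra.res h𝔥.le (β + α') ≠ 0 := by
        rw [map_add, hres]
        exact fun h0 => hne' (eq_neg_of_add_eq_zero_left h0)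
      have h2 : LieSuperalgebra.res h𝔥.le (β - α') ≠ 0 := by
        rw [map_sub, hres]
        exact sub_ne_zero.mpr hne
      exact (LieSuperalgebra.isWeight_add_or_sub B hnd ht hα'.2 hβ.2 h).imp
        (fun hw => ⟨h1, _, ⟨fun h0 => h1 (by rw [h0, map_zero]), hw⟩, rfl⟩)
        (fun hw => ⟨h2, _, ⟨fun h0 => h2 (by rw [h0, map_zero]), hw⟩, rfl⟩)
    by_cases h : B.onDual 𝔥 α β = 0
    · refine key (-θ.dualAct h𝔥.stable α) (LieSuperalgebra.neg_mem_roots B ht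
        (LieSuperalgebra.dualAct_mem_roots h𝔥.stable hα))
        (by rw [map_neg, LieSuperalgebra.res_dualAct h𝔥.stable h𝔞, neg_neg]) fun h' => hQ ?_
      have := LieSuperalgebra.onDual_res_res hB h𝔞 h𝔥 hnd α β
      rw [map_neg, LinearMap.neg_apply, neg_eq_zero] at h'
      rw [h, h', sub_zero, mul_eq_zero] at this
      exact this.resolve_left two_ne_zero
    · exact key α hα rfl h
  · exact isFormRootSystem_of_reflection_mem (hfin.subset hsub) (fun a ha => (hre a ha).1)
      (fun a ha b hb => ((hre a ha).2 b (hsub hb)).1) hrere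
  · intro w hw
    refine image_eq_of_mem_formWeylGroup (fun a ha => (hre a ha).1) ?_ hw
    -- a reflection in a real root preserves all roots and, being involutive, also the nonreal ones
    rintro a ha b ⟨hb, hb'⟩
    have ha0 := (hre a ha).1
    refine ⟨formReflection_apply (Q := Q) a b ▸ ((hre a ha).2 b hb).2, fun h => hb' ?_⟩
    have h2 := hrere a ha _ h
    rwa [← formReflection_apply, formReflection_formReflection ha0] at h2
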